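/- An instance consists of a finite directed graph $G=(V,E)$, nodes $s,t\in V$, a battery capacity $\overline B$, an initial charge $B_0\in[0,\overline B]$, and for every edge $e$ a fuel consumption function $c_{f,e}:[0,1]\to\mathbb R_{\ge 0}$ and a battery consumption function $c_{b,e}:[0,1]\to\mathbb R$ of a strategy parameter $\alpha$. Both are differentiable; $c_{f,e}$ is non-decreasing and $c_{b,e}$ is non-increasing ($\alpha$ runs from saving fuel and depleting the battery to spending fuel and charging it). An $s$-$t$-path is a sequence $(e_1,\alpha_1),\dots,(e_k,\alpha_k)$, $k\ge 0$, of edges that fit head to tail and lead from $s$ to $t$ (repetitions are allowed; for $s=t$ the empty path counts), with parameters $\alpha_i\in[0,1]$. It is feasible if the charges $B_i=B_{i-1}-c_{b,e_i}(\alpha_i)$ satisfy $0\le B_i\le\overline B$ for $i=1,\dots,k$. Its fuel consumption is $\sum_i c_{f,e_i}(\alpha_i)$. Assume: - (Conservative functions) for every cycle $(e_1,\dots,e_k)$ and all $\alpha_i\in[0,1]$, $\sum_i c_{f,e_i}(\alpha_i)>0$ or $\sum_i c_{b,e_i}(\alpha_i)>0$; - (Cycle prevention condition I) for every edge $e$ there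 is $\alpha^0_e\in[0,1]$ with $c_{b,e}(\alpha^0_e)=0$; - (Cycle prevention condition II) for every cycle $(e_1,\dots,e_k)$, all $\alpha_i\in[0,1]$, every edge $\ell$ and every $\alpha\in[0,1]$ at which $c_{f,\ell}'$ and $c_{b,\ell}'$ do not both vanish, $$\frac{\sum_{i} c_{f,e_i}(\alpha_i)}{\left|\sum_{i} c_{b,e_i}(\alpha_i)\right|}>-\frac{c_{f,\ell}'(\alpha)}{c_{b,\ell}'(\alpha)},$$ where the left side is $+\infty$ if its denominator is $0$ (the numerator is then positive), the right side is $+\infty$ if $c_{b,\ell}'(\alpha)=0$, and the inequality fails if both sides are $+\infty$. The model of computation is a real RAM: one fixed program with registers and arrays of natural and of real numbers; arithmetic ($+,-,\times,\div$ on reals, $+$ and truncated $-$ on naturals), comparisons and memory accesses each take one time step, and so do lookups of the end nodes of an edge and the operations concerning $c_{f,e}$ and $c_{b,e}$, namely evaluation and computation of the largest $\alpha\in[0,1]$ with $c_{f,e}(\alpha)\le y$, or with $c_{b,e}(\alpha)\ge y$, for given $y$. **Theorem.** There are a single program of this kind and a polynomial $p$ such that, for every instance as above and every $\varepsilon>0$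 (given as input), the program halts with the following output: if there is a feasible $s$-$t$-path, a feasible $s$-$t$-path whose fuel consumption is at most $(1+\varepsilon)$ times that of every feasible $s$-$t$-path; otherwise, the report that there is none. The number of time steps is at most $p(|V|+|E|+L+1/\varepsilon)$, where $L$ is the size of the numerical input in either of the following senses: 1. (arbitrary functions) $L$ is any natural number such that all fuel consumption values $c_{f,e}(\alpha)$ are at most $2^L$ times the fuel consumption of every feasible $s$-$t$-path (any $L\ge 0$ is allowed if there is a feasible path with fuel consumption $0$); 2. (linear functions) if $c_{f,e}(\alpha)=p_e+q_e\alpha$ and $c_{b,e}(\alpha)=r_e+w_e\alpha$ with rational $p_e,q_e,r_e,w_e$, and $B_0,\overline B$ are rational, $L$ is the total binary encoding length of these rational numbers. -/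

import Mathlib

namespace HybridRouting

/-! ### Instances -/

/-- The data of an instance: a finite directed graph with nodes `Fin n` and edges `Fin m` (loops and
parallel edges are allowed), fuel and battery consumption functions of the strategy parameter
(only their values on `[0,1]` matter), source, target, initial battery charge and capacity. -/
structure Instance (n m : ℕ) where
  src : Fin m → Fin n
  tgt : Fin m → Fin n
  fuel : Fin m → ℝ → ℝ
  batt : Fin m → ℝ → ℝ
  s : Fin n
  t : Fin n
  B₀ : ℝ
  cap : ℝ

/-- A sequence of pairs (edge, strategy parameter). -/
abbrev Route (m : ℕ) := List (Fin m × ℝ)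

namespace Instance

variable {n m : ℕ} (I : Instance n m)

/-- `P` is a path from `u` to `v`: its edges fit head to tail and its parameters lie in `[0,1]`.
Nodes and edges may be repeated. -/
def IsPath : Fin n → Fin n → Route m → Prop
  | u, v, [] => u = v
  | u, v, p :: P => I.src p.1 = u ∧ p.2 ∈ Set.Icc (0 : ℝ) 1 ∧ IsPath (I.tgt p.1) v P

/-- Starting with charge `b`, the charge after every edge of the route is in `[0, cap]`. -/
def ChargeOK : ℝ → Route m → Prop
  | _, [] => True
  | b, p :: P => b - I.batt p.1 p.2 ∈ Set.Icc 0 I.cap ∧ ChargeOK (b - I.batt p.1 p.2) P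

/-- Total fuel consumption of a route. -/
def totalFuel (P : Route m) : ℝ := (P.map fun p => I.fuel p.1 p.2).sum

/-- Total battery consumption of a route. -/
def totalBatt (P : Route m) : ℝ := (P.map fun p => I.batt p.1 p.2).sum

/-- Feasible `s`-`t`-paths. -/
def Feasible (P : Route m) : Prop := I.IsPath I.s I.t P ∧ I.ChargeOK I.B₀ P

/-- A cycle, together with a choice of strategy parameters on its edges: a nonempty closed path
that visits no node twice. -/
def IsCycle (C : Route m) : Prop :=
  C ≠ [] ∧ (∃ v, I.IsPath v v C) ∧ (C.map fun p => I.tgt p.1).Nodup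

/-- The standing assumptions of the model: fuel consumption is nonnegative, both consumptions are
differentiable on `[0,1]`, a larger parameter means at least as much fuel and at most as much
battery consumption, the initial charge obeys the capacity bounds, and the consumption functions
are conservative. -/
structure Admissible : Prop where
  fuel_nonneg : ∀ e, ∀ a ∈ Set.Icc (0 : ℝ) 1, 0 ≤ I.fuel e a
  fuel_diff : ∀ e, DifferentiableOn ℝ (I.fuel e) (Set.Icc 0 1)
  batt_diff : ∀ e, DifferentiableOn ℝ (I.batt e) (Set.Icc 0 1)
  fuel_mono : ∀ e, MonotoneOn (I.fuel e) (Set.Icc 0 1)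
  batt_anti : ∀ e, AntitoneOn (I.batt e) (Set.Icc 0 1)
  charge_mem : I.B₀ ∈ Set.Icc 0 I.cap
  conservative : ∀ C, I.IsCycle C → 0 < I.totalFuel C ∨ 0 < I.totalBatt C

/-- Cycle prevention condition I: every edge has a strategy that leaves the battery unchanged. -/
def CyclePreventionI : Prop := ∀ e, ∃ a ∈ Set.Icc (0 : ℝ) 1, I.batt e a = 0

/-- Derivative of the fuel consumption of `e` at `a` (one-sided at `0` and `1`). -/
noncomputable def fuelRate (e : Fin m) (a : ℝ) : ℝ := derivWithin (I.fuel e) (Set.Icc 0 1) a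

/-- Derivative of the battery consumption of `e` at `a` (one-sided at `0` and `1`). -/
noncomputable def battRate (e : Fin m) (a : ℝ) : ℝ := derivWithin (I.batt e) (Set.Icc 0 1) a

/-- Cycle prevention condition II:
`totalFuel C / |totalBatt C| > - fuelRate l a / battRate l a` for all cycles `C` (with parameters),
edges `l` and `a ∈ [0,1]`. The denominators are cleared (`battRate l a ≤ 0`), so that the left hand
side counts as `+∞` when `totalBatt C = 0`, and the right hand side as `+∞` when `battRate l a = 0`
and `fuelRate l a ≠ 0`. Nothing is required at points where both rates vanish, since nothing is
exchanged there. -/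
def CyclePreventionII : Prop :=
  ∀ C, I.IsCycle C → ∀ l, ∀ a ∈ Set.Icc (0 : ℝ) 1, (I.fuelRate l a ≠ 0 ∨ I.battRate l a ≠ 0) →
    I.fuelRate l a * |I.totalBatt C| < I.totalFuel C * (-I.battRate l a)

/-! ### The size of the numerical input -/

/-- The fuel values span at most `L` binary orders of magnitude above the optimum: unless
there is a feasible path with zero consumption, no edge consumes more than `2 ^ L` times the
consumption of a feasible path. This measures the numerical part of the input when the consumption
functions are arbitrary and can only be accessed by unit-time operations. -/
def FuelRange (L : ℕ) : Prop :=
  (∃ Q, I.Feasible Q ∧ I.totalFuel Q = 0) ∨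
    ∀ Q, I.Feasible Q → ∀ e, ∀ a ∈ Set.Icc (0 : ℝ) 1, I.fuel e a ≤ 2 ^ L * I.totalFuel Q

end Instance

/-- Binary encoding length of a rational number. -/
def bitLength (q : ℚ) : ℕ := Nat.size q.num.natAbs + Nat.size q.den

/-- Explicit numerical input for linear consumption functions with rational coefficients. -/
structure LinearData (m : ℕ) where
  fuel₀ : Fin m → ℚ
  fuel₁ : Fin m → ℚ
  batt₀ : Fin m → ℚ
  batt₁ : Fin m → ℚ
  B₀ : ℚ
  cap : ℚ

/-- Total encoding length of all the rational numbers in the input. -/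
def LinearData.bitLength {m : ℕ} (D : LinearData m) : ℕ :=
  (∑ e, (HybridRouting.bitLength (D.fuel₀ e) + HybridRouting.bitLength (D.fuel₁ e) +
    HybridRouting.bitLength (D.batt₀ e) + HybridRouting.bitLength (D.batt₁ e))) +
    HybridRouting.bitLength D.B₀ + HybridRouting.bitLength D.cap

/-- The consumption functions of `I` are the linear ones given by `D`, and so are `B₀`, `cap`. -/
def LinearData.Represents {n m : ℕ} (D : LinearData m) (I : Instance n m) : Prop :=
  (∀ e, ∀ a ∈ Set.Icc (0 : ℝ) 1, I.fuel e a = D.fuel₀ e + D.fuel₁ e * a ∧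
    I.batt e a = D.batt₀ e + D.batt₁ e * a) ∧ I.B₀ = D.B₀ ∧ I.cap = D.cap

/-! ### The machine model

A real RAM. Programs are finite `while`-programs over natural and real registers and arrays (with
computed indices). The graph and the consumption functions are accessed by unit-time operations.
There is no rounding of reals, and the only operations on naturals are addition and truncated
subtraction. -/

/-- Tests on registers. -/
inductive Test where
  /-- natural register `x` is smaller than natural register `y` -/
  | natLt (x y : ℕ)
  /-- real register `x` is smaller than real register `y` -/
  | realLt (x y : ℕ)

/-- Elementary operations; arguments are the numbers of registers or of arrays. -/
inductive Op where
  | natConst (x : ℕ) (k : ℕ)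
  | natAdd (x y z : ℕ)
  | natSub (x y z : ℕ)
  | natLoad (x arr i : ℕ)
  | natStore (arr i x : ℕ)
  | realConst (x : ℕ) (q : ℚ)
  | realAdd (x y z : ℕ)
  | realSub (x y z : ℕ)
  | realMul (x y z : ℕ)
  | realDiv (x y z : ℕ)
  | realLoad (x arr i : ℕ)
  | realStore (arr i x : ℕ)
  | edgeSrc (x e : ℕ)
  | edgeTgt (x e : ℕ)
  | evalFuel (x e a : ℕ)
  | evalBatt (x e a : ℕ)
  | invFuel (x e y : ℕ)
  | invBatt (x e y : ℕ)

/-- Programs. -/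
inductive Program where
  | op (o : Op)
  | seq (c d : Program)
  | cond (b : Test) (c d : Program)
  | loop (b : Test) (c : Program)

/-- Memory: natural registers, real registers, natural arrays, real arrays. -/
structure Memory where
  nat : ℕ → ℕ
  real : ℕ → ℝ
  natArr : ℕ → ℕ → ℕ
  realArr : ℕ → ℕ → ℝ

namespace Memory

def setNat (σ : Memory) (x k : ℕ) : Memory := { σ with nat := Function.update σ.nat x k }

noncomputable def setReal (σ : Memory) (x : ℕ) (r : ℝ) : Memory :=
  { σ with real := Function.update σ.real x r }

def setNatArr (σ : Memory) (arr i k : ℕ) : Memory :=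
  { σ with natArr := Function.update σ.natArr arr (Function.update (σ.natArr arr) i k) }

noncomputable def setRealArr (σ : Memory) (arr i : ℕ) (r : ℝ) : Memory :=
  { σ with realArr := Function.update σ.realArr arr (Function.update (σ.realArr arr) i r) }

end Memory

def Test.Holds (σ : Memory) : Test → Prop
  | natLt x y => σ.nat x < σ.nat y
  | realLt x y => σ.real x < σ.real y

/-- A function of edges, at the edge with number `k` (and the default value if there is none). -/
def atEdge {m : ℕ} {β : Type} (k : ℕ) (default : β) (f : Fin m → β) : β :=
  if h : k < m then f ⟨k, h⟩ else default

/-- Effect of an elementary operation. The two inverse operations return the largest strategy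
parameter whose fuel consumption is at most a given value, respectively whose battery consumption
is at least a given value. -/
noncomputable def Op.apply {n m : ℕ} (I : Instance n m) (σ : Memory) : Op → Memory
  | natConst x k => σ.setNat x k
  | natAdd x y z => σ.setNat x (σ.nat y + σ.nat z)
  | natSub x y z => σ.setNat x (σ.nat y - σ.nat z)
  | natLoad x arr i => σ.setNat x (σ.natArr arr (σ.nat i))
  | natStore arr i x => σ.setNatArr arr (σ.nat i) (σ.nat x)
  | realConst x q => σ.setReal x q
  | realAdd x y z => σ.setReal x (σ.real y + σ.real z)
  | realSub x y z => σ.setReal x (σ.real y - σ.real z)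
  | realMul x y z => σ.setReal x (σ.real y * σ.real z)
  | realDiv x y z => σ.setReal x (σ.real y / σ.real z)
  | realLoad x arr i => σ.setReal x (σ.realArr arr (σ.nat i))
  | realStore arr i x => σ.setRealArr arr (σ.nat i) (σ.real x)
  | edgeSrc x e => σ.setNat x (atEdge (σ.nat e) 0 fun k => (I.src k : ℕ))
  | edgeTgt x e => σ.setNat x (atEdge (σ.nat e) 0 fun k => (I.tgt k : ℕ))
  | evalFuel x e a => σ.setReal x (atEdge (σ.nat e) 0 fun k => I.fuel k (σ.real a))
  | evalBatt x e a => σ.setReal x (atEdge (σ.nat e) 0 fun k => I.batt k (σ.real a))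
  | invFuel x e y => σ.setReal x (atEdge (σ.nat e) 0 fun k =>
      sSup {a | a ∈ Set.Icc (0 : ℝ) 1 ∧ I.fuel k a ≤ σ.real y})
  | invBatt x e y => σ.setReal x (atEdge (σ.nat e) 0 fun k =>
      sSup {a | a ∈ Set.Icc (0 : ℝ) 1 ∧ σ.real y ≤ I.batt k a})

/-- `Exec I c σ τ T`: on the instance `I`, the program `c` started in memory `σ` halts in memory `τ`
after `T` steps; every elementary operation and every evaluation of a test is one step. -/
inductive Exec {n m : ℕ} (I : Instance n m) : Program → Memory → Memory → ℕ → Prop where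
  | op (o : Op) (σ : Memory) : Exec I (.op o) σ (o.apply I σ) 1
  | seq {c d : Program} {σ τ ρ : Memory} {T U : ℕ} :
      Exec I c σ τ T → Exec I d τ ρ U → Exec I (.seq c d) σ ρ (T + U)
  | condTrue {b : Test} {c d : Program} {σ τ : Memory} {T : ℕ} :
      b.Holds σ → Exec I c σ τ T → Exec I (.cond b c d) σ τ (T + 1)
  | condFalse {b : Test} {c d : Program} {σ τ : Memory} {T : ℕ} :
      ¬ b.Holds σ → Exec I d σ τ T → Exec I (.cond b c d) σ τ (T + 1)
  | loopEnd {b : Test} {c : Program} {σ : Memory} :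
      ¬ b.Holds σ → Exec I (.loop b c) σ σ 1
  | loopStep {b : Test} {c : Program} {σ τ ρ : Memory} {T U : ℕ} :
      b.Holds σ → Exec I c σ τ T → Exec I (.loop b c) τ ρ U → Exec I (.loop b c) σ ρ (T + U + 1)

/-- Initial memory: natural registers `0,1,2,3` hold the numbers of nodes and edges, source and
target; real registers `0,1,2` hold `ε`, the initial charge and the capacity; all else is `0`. -/
noncomputable def inputMemory {n m : ℕ} (I : Instance n m) (ε : ℝ) : Memory where
  nat x := if x = 0 then n else if x = 1 then m else if x = 2 then I.s else if x = 3 then I.t else 0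
  real x := if x = 0 then ε else if x = 1 then I.B₀ else if x = 2 then I.cap else 0
  natArr _ _ := 0
  realArr _ _ := 0

/-- The memory shows the route `P`: natural register `0` is one more than its length, its edges and
parameters are in the natural and the real array `0`. -/
def Memory.Shows {m : ℕ} (σ : Memory) (P : Route m) : Prop :=
  σ.nat 0 = P.length + 1 ∧
    ∀ i (h : i < P.length), σ.natArr 0 i = (P[i].1 : ℕ) ∧ σ.realArr 0 i = P[i].2

/-- The memory reports that no route was found. -/
def Memory.ShowsNone (σ : Memory) : Prop := σ.nat 0 = 0

/-- A correct answer: a feasible path with fuel consumption at most `1 + ε` times that of every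
feasible path, or the report that there is no feasible path, if this is so. -/
def IsApproxAnswer {n m : ℕ} (I : Instance n m) (ε : ℝ) (σ : Memory) : Prop :=
  (∃ P, σ.Shows P ∧ I.Feasible P ∧
    ∀ Q, I.Feasible Q → I.totalFuel P ≤ (1 + ε) * I.totalFuel Q) ∨
  (σ.ShowsNone ∧ ∀ Q, ¬ I.Feasible Q)

end HybridRouting

/-! The proof combines three facts.

Cycles are useless (`Admissible.exists_short`). Deleting a cycle that does not charge the battery
leaves at least as much charge for the rest of the path. Condition I then allows the parameters to
be lowered so that the capacity is respected. Deleting a cycle that charges by W using fuel F leaves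
a deficit W. By condition II every edge trades fuel for charge at a rate of at most F/W, so the rest
can make up the deficit with at most the fuel F saved. Hence paths with fewer than n edges suffice.

Rounded fuel admits a dynamic program (`wp_search`). For a bound X, fuel is budgeted in units δ =
X/M. For each node and each total budget jδ the largest reachable charge is kept; more charge is
never worse (`Admissible.driveParam_optimal`), so one label per pair is enough. Rounding up costs at
most one unit per edge, hence M + n units hold every short path of fuel at most X. A search thus
returns a path of fuel at most (1 + n/M)X or certifies that every feasible path needs more than X.

The optimum is located geometrically (`wp_mainLoop`, `wp_scheme`). A search with X = 0 settles the
case of optimum zero. Otherwise X starts at an upper bound for short paths and is divided by q = 1 +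
ε₁ until a search fails. The last path found is then within q² ≤ 1 + ε of the optimum.

The number of searches is governed by the ratio of the fuel values to the optimum. This ratio is
finite for every instance, by a compactness argument (`Admissible.exists_fuelRange`), and at most
2^(3ℓ+2) for linear data of length ℓ, because the charges of fuel-free paths lie on a grid
(`LinearData.Represents.fuelRange`). -/

namespace HybridRouting
namespace Instance

variable {n m : ℕ} {I : Instance n m}

/-! ### Routes -/

@[simp] theorem totalFuel_nil : I.totalFuel [] = 0 := rfl

@[simp] theorem totalBatt_nil : I.totalBatt [] = 0 := rfl

@[simp] theorem totalFuel_cons (p : Fin m × ℝ) (P : Route m) :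
    I.totalFuel (p :: P) = I.fuel p.1 p.2 + I.totalFuel P := by
  simp [totalFuel]

@[simp] theorem totalBatt_cons (p : Fin m × ℝ) (P : Route m) :
    I.totalBatt (p :: P) = I.batt p.1 p.2 + I.totalBatt P := by
  simp [totalBatt]

theorem totalFuel_append (P Q : Route m) :
    I.totalFuel (P ++ Q) = I.totalFuel P + I.totalFuel Q := by
  simp [totalFuel]

theorem totalBatt_append (P Q : Route m) :
    I.totalBatt (P ++ Q) = I.totalBatt P + I.totalBatt Q := by
  simp [totalBatt]

theorem isPath_append {u v : Fin n} {P Q : Route m} :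
    I.IsPath u v (P ++ Q) ↔ ∃ w, I.IsPath u w P ∧ I.IsPath w v Q := by
  induction P generalizing u with
  | nil => simp [IsPath]
  | cons p P ih => simp [IsPath, ih, and_assoc]

theorem chargeOK_append {b : ℝ} {P Q : Route m} :
    I.ChargeOK b (P ++ Q) ↔ I.ChargeOK b P ∧ I.ChargeOK (b - I.totalBatt P) Q := by
  induction P generalizing b with
  | nil => simp [ChargeOK]
  | cons p P ih => simp [ChargeOK, ih, and_assoc, sub_sub]

theorem ChargeOK.final_mem {b : ℝ} {P : Route m} (h : I.ChargeOK b P) (hb : b ∈ Set.Icc 0 I.cap) :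
    b - I.totalBatt P ∈ Set.Icc 0 I.cap := by
  induction P generalizing b with
  | nil => simpa using hb
  | cons p P ih =>
    have := ih h.2 h.1
    rwa [sub_sub, ← totalBatt_cons] at this

theorem IsPath.param_mem {u v : Fin n} {P : Route m} (h : I.IsPath u v P) :
    ∀ p ∈ P, p.2 ∈ Set.Icc (0 : ℝ) 1 := by
  induction P generalizing u with
  | nil => simp
  | cons p P ih =>
    intro q hq
    rcases List.mem_cons.1 hq with rfl | hq
    · exact h.2.1
    · exact ih h.2.2 q hq

theorem Admissible.totalFuel_nonneg (hI : I.Admissible) {P : Route m}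
    (hP : ∀ p ∈ P, p.2 ∈ Set.Icc (0 : ℝ) 1) : 0 ≤ I.totalFuel P := by
  refine List.sum_nonneg ?_
  intro x hx
  obtain ⟨p, hp, rfl⟩ := List.mem_map.1 hx
  exact hI.fuel_nonneg _ _ (hP p hp)

theorem Admissible.fuel_le_totalFuel (hI : I.Admissible) {P : Route m}
    (hP : ∀ p ∈ P, p.2 ∈ Set.Icc (0 : ℝ) 1) {p : Fin m × ℝ} (hp : p ∈ P) :
    I.fuel p.1 p.2 ≤ I.totalFuel P := by
  refine List.single_le_sum ?_ _ (List.mem_map.2 ⟨p, hp, rfl⟩)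
  intro x hx
  obtain ⟨q, hq, rfl⟩ := List.mem_map.1 hx
  exact hI.fuel_nonneg _ _ (hP q hq)

/-! ### Adapting a route to a different charge -/

/-- Intermediate values of the battery consumption. -/
theorem Admissible.exists_batt_eq (hI : I.Admissible) (e : Fin m) {a c y : ℝ}
    (ha : a ∈ Set.Icc (0 : ℝ) 1) (hc : c ∈ Set.Icc (0 : ℝ) 1)
    (hca : I.batt e c ≤ y) (hy : y ≤ I.batt e a) :
    ∃ x ∈ Set.Icc (0 : ℝ) 1, I.batt e x = y := by
  have hconn : IsPreconnected (Set.Icc (0 : ℝ) 1) := isPreconnected_Icc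
  exact hconn.intermediate_value hc ha (hI.batt_diff e).continuousOn ⟨hca, hy⟩

theorem Admissible.le_of_batt_lt (hI : I.Admissible) {e : Fin m} {a c : ℝ}
    (ha : a ∈ Set.Icc (0 : ℝ) 1) (hc : c ∈ Set.Icc (0 : ℝ) 1)
    (h : I.batt e a < I.batt e c) : c ≤ a := by
  by_contra! hlt
  exact absurd (hI.batt_anti e ha hc hlt.le) (not_le.2 h)

/-- One edge can be driven with a larger charge: the charge stays ahead, up to the capacity. -/
theorem Admissible.exists_clamp (hI : I.Admissible) (h1 : I.CyclePreventionI) (e : Fin m) {a b : ℝ}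
    (ha : a ∈ Set.Icc (0 : ℝ) 1) (hb : b ≤ I.cap) :
    ∃ x ∈ Set.Icc (0 : ℝ) 1, x ≤ a ∧ b - I.batt e x = min I.cap (b - I.batt e a) := by
  rcases le_or_gt (b - I.batt e a) I.cap with h | h
  · exact ⟨a, ha, le_rfl, by rw [min_eq_right h]⟩
  · obtain ⟨z, hz, hz0⟩ := h1 e
    obtain ⟨x, hx, hxe⟩ := hI.exists_batt_eq e (y := b - I.cap) hz ha (by linarith) (by linarith)
    refine ⟨x, hx, hI.le_of_batt_lt ha hx (by linarith), ?_⟩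
    rw [min_eq_left h.le]; linarith

/-- Each edge is driven with its old parameter, or a smaller one that lands exactly on the capacity.
The charge never falls behind the old one, and lowering parameters does not increase fuel. -/
theorem Admissible.exists_route_of_le_charge (hI : I.Admissible) (h1 : I.CyclePreventionI)
    {R : Route m} {u v : Fin n} {b b' : ℝ} (hR : I.IsPath u v R) (hc : I.ChargeOK b R)
    (hb : b ≤ b') (hb' : b' ≤ I.cap) :
    ∃ R' : Route m, I.IsPath u v R' ∧ I.ChargeOK b' R' ∧ R'.length = R.length ∧
      I.totalFuel R' ≤ I.totalFuel R := by
  induction R generalizing u b b' with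
  | nil => exact ⟨[], hR, trivial, rfl, le_rfl⟩
  | cons p R ih =>
    obtain ⟨x, hx, hxa, hxe⟩ := hI.exists_clamp h1 p.1 hR.2.1 hb'
    obtain ⟨R', hR', hc', hl, hf⟩ := ih (b' := b' - I.batt p.1 x) hR.2.2 hc.2
      (by rw [hxe]; exact le_min hc.1.2 (by linarith)) (by rw [hxe]; exact min_le_left _ _)
    refine ⟨(p.1, x) :: R', ⟨hR.1, hx, hR'⟩, ⟨⟨?_, ?_⟩, hc'⟩, by simp [hl], ?_⟩
    · simp only [hxe]; exact le_min (hc.1.1.trans hc.1.2) (hc.1.1.trans (by linarith))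
    · simp only [hxe]; exact min_le_left _ _
    · simpa using add_le_add (hI.fuel_mono p.1 hx hR.2.1 hxa) hf

/-- `hFW` says that a unit of charge costs at most F/W fuel, in a form that also makes sense for W =
0. A parameter is raised only when the charge would become negative, and then only until it is zero.
So the new charge never overtakes the old one, and W · (fuel spent) + F · (deficit) exceeds W · (old
fuel) by no more than the initial F · (deficit). -/
theorem Admissible.exists_route_of_charge_le (hI : I.Admissible) (h1 : I.CyclePreventionI)
    {F W : ℝ} (hFW : ∀ e, AntitoneOn (fun a => W * I.fuel e a + F * I.batt e a) (Set.Icc 0 1))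
    (hF : 0 ≤ F) {R : Route m} {u v : Fin n} {b b' : ℝ} (hR : I.IsPath u v R)
    (hc : I.ChargeOK b R) (hb : b' ≤ b) (hb' : 0 ≤ b') :
    ∃ R' : Route m, I.IsPath u v R' ∧ I.ChargeOK b' R' ∧ R'.length = R.length ∧
      W * I.totalFuel R' ≤ W * I.totalFuel R + F * (b - b') := by
  induction R generalizing u b b' with
  | nil => exact ⟨[], hR, trivial, rfl, by simpa using mul_nonneg hF (sub_nonneg.2 hb)⟩
  | cons p R ih =>
    obtain ⟨x, hx, hx0, hxb, hxf⟩ : ∃ x ∈ Set.Icc (0 : ℝ) 1, 0 ≤ b' - I.batt p.1 x ∧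
        b' - I.batt p.1 x ≤ b - I.batt p.1 p.2 ∧ W * I.fuel p.1 x + F * I.batt p.1 x ≤
          W * I.fuel p.1 p.2 + F * I.batt p.1 p.2 := by
      rcases le_or_gt 0 (b' - I.batt p.1 p.2) with h | h
      · exact ⟨p.2, hR.2.1, h, by linarith, le_rfl⟩
      -- The parameter from condition I consumes nothing, the old one more than b'. In between lies
      -- one that consumes exactly b', leaving charge zero.
      · obtain ⟨z, hz, hz0⟩ := h1 p.1
        obtain ⟨x, hx, hxe⟩ := hI.exists_batt_eq p.1 (y := b') hR.2.1 hz (by linarith)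
          (by linarith)
        exact ⟨x, hx, by linarith, by linarith [hc.1.1],
          hFW p.1 hR.2.1 hx (hI.le_of_batt_lt hx hR.2.1 (by linarith))⟩
    obtain ⟨R', hR', hc', hl, hf⟩ := ih hR.2.2 hc.2 hxb hx0
    refine ⟨(p.1, x) :: R', ⟨hR.1, hx, hR'⟩, ⟨⟨hx0, hxb.trans hc.1.2⟩, hc'⟩, by simp [hl], ?_⟩
    simp only [totalFuel_cons]
    nlinarith

/-! ### Removal of cycles -/

theorem IsCycle.param_mem {C : Route m} (hC : I.IsCycle C) : ∀ p ∈ C, p.2 ∈ Set.Icc (0 : ℝ) 1 :=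
  hC.2.1.choose_spec.param_mem

/-- No exchange of fuel for charge is more expensive than the one done by a cycle. -/
theorem Admissible.antitoneOn_exchange (hI : I.Admissible) (h2 : I.CyclePreventionII) {C : Route m}
    (hC : I.IsCycle C) (e : Fin m) :
    AntitoneOn (fun a => |I.totalBatt C| * I.fuel e a + I.totalFuel C * I.batt e a)
      (Set.Icc 0 1) := by
  have hd : ∀ a ∈ Set.Icc (0 : ℝ) 1, HasDerivWithinAt
      (fun a => |I.totalBatt C| * I.fuel e a + I.totalFuel C * I.batt e a)
      (|I.totalBatt C| * I.fuelRate e a + I.totalFuel C * I.battRate e a) (Set.Icc 0 1) a :=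
    fun a ha => ((hI.fuel_diff e a ha).hasDerivWithinAt.const_mul _).add
      ((hI.batt_diff e a ha).hasDerivWithinAt.const_mul _)
  refine antitoneOn_of_hasDerivWithinAt_nonpos (convex_Icc 0 1)
    (fun a ha => (hd a ha).continuousWithinAt)
    (fun a ha => (hd a (interior_subset ha)).mono interior_subset) ?_
  intro a ha
  -- With cleared denominators, condition II is the sign of the derivative; where both rates vanish
  -- the derivative is zero.
  by_cases h0 : I.fuelRate e a ≠ 0 ∨ I.battRate e a ≠ 0
  · have := h2 C hC e a (interior_subset ha) h0
    linarith
  · push Not at h0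
    simp [h0.1, h0.2]

/-- The remainder R is adapted to the charge available before C. If C charges the battery, the
deficit equals W = |`I.totalBatt C`|. The exchange bound then gives W · (extra fuel) ≤ `I.totalFuel
C` · W, and W cancels. -/
theorem Admissible.exists_remove_cycle (hI : I.Admissible) (h1 : I.CyclePreventionI)
    (h2 : I.CyclePreventionII) {A C R : Route m} (hC : I.IsCycle C)
    (hf : I.Feasible (A ++ (C ++ R))) :
    ∃ Q, I.Feasible Q ∧ Q.length < (A ++ (C ++ R)).length ∧
      I.totalFuel Q ≤ I.totalFuel (A ++ (C ++ R)) := by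
  obtain ⟨hp, hc⟩ := hf
  obtain ⟨w, hA, hCR⟩ := isPath_append.1 hp
  obtain ⟨w', hCp, hR⟩ := isPath_append.1 hCR
  obtain ⟨hcA, hcCR⟩ := chargeOK_append.1 hc
  obtain ⟨hcC, hcR⟩ := chargeOK_append.1 hcCR
  have hbA := hcA.final_mem hI.charge_mem
  set b := I.B₀ - I.totalBatt A with hbdef
  have hww : w' = w := by
    obtain ⟨z, hz⟩ := hC.2.1
    obtain ⟨p, C, rfl⟩ := List.exists_cons_of_ne_nil hC.1
    have key : ∀ (C : Route m) (x y y' : Fin n), I.IsPath x y C → I.IsPath x y' C → y = y' := by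
      intro C
      induction C with
      | nil => intro x y y' h h'; exact (Eq.symm h).trans h'
      | cons q C ih => intro x y y' h h'; exact ih _ _ _ h.2.2 h'.2.2
    have hzw : z = w := hz.1.symm.trans hCp.1
    exact (key _ _ _ _ hCp (hzw ▸ hz))
  subst hww
  have hlen : 0 < C.length := List.length_pos_of_ne_nil hC.1
  have hCf : 0 ≤ I.totalFuel C := hI.totalFuel_nonneg hC.param_mem
  suffices h : ∃ R', I.IsPath w' I.t R' ∧ I.ChargeOK b R' ∧ R'.length = R.length ∧
      I.totalFuel R' ≤ I.totalFuel R + I.totalFuel C by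
    obtain ⟨R', hR', hc', hl, hf⟩ := h
    refine ⟨A ++ R', ⟨isPath_append.2 ⟨w', hA, hR'⟩, chargeOK_append.2 ⟨hcA, hc'⟩⟩, ?_, ?_⟩
    · simp only [List.length_append, hl]; omega
    · simp only [totalFuel_append]; linarith
  rcases le_or_gt 0 (I.totalBatt C) with h | h
  · obtain ⟨R', hR', hc', hl, hf⟩ := hI.exists_route_of_le_charge h1 hR hcR
      (b' := b) (by linarith) hbA.2
    exact ⟨R', hR', hc', hl, by linarith⟩
  · obtain ⟨R', hR', hc', hl, hf⟩ := hI.exists_route_of_charge_le h1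
      (hI.antitoneOn_exchange h2 hC) hCf hR hcR (b' := b) (by linarith) hbA.1
    refine ⟨R', hR', hc', hl, ?_⟩
    rw [abs_of_neg h] at hf
    nlinarith

/-- Induction from the front. If the tail repeats no node but returns to u, the initial segment up
to that return is a cycle: its targets are distinct because those of the whole path are. -/
theorem exists_cycle_or_nodup {u v : Fin n} {P : Route m} (hP : I.IsPath u v P) :
    (∃ A C R, P = A ++ (C ++ R) ∧ I.IsCycle C) ∨ (u :: P.map fun p => I.tgt p.1).Nodup := by
  induction P generalizing u with
  | nil => right; simp
  | cons p P ih =>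
    rcases ih hP.2.2 with ⟨A, C, R, rfl, hC⟩ | hnd
    · exact Or.inl ⟨p :: A, C, R, rfl, hC⟩
    · by_cases hu : u ∈ (p :: P).map fun p => I.tgt p.1
      · left
        obtain ⟨q, hq, hqu⟩ := List.mem_map.1 hu
        obtain ⟨S, R, hSR⟩ := List.append_of_mem hq
        have hSR' : p :: P = (S ++ [q]) ++ R := by simp [hSR]
        refine ⟨[], S ++ [q], R, by simpa using hSR', by simp, ⟨u, ?_⟩, ?_⟩
        · rw [hSR'] at hP
          obtain ⟨w, hw, -⟩ := isPath_append.1 hP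
          obtain ⟨z, hz, hz'⟩ := isPath_append.1 hw
          have : I.tgt q.1 = w := hz'.2.2
          rwa [← this, hqu] at hw
        · have hnd' : ((p :: P).map fun p => I.tgt p.1).Nodup := by simpa using hnd
          rw [hSR', List.map_append] at hnd'
          exact (List.nodup_append.1 hnd').1
      · right
        exact List.nodup_cons.2 ⟨hu, by simpa using hnd⟩

/-- Feasible paths without repeated nodes suffice. -/
theorem Admissible.exists_short (hI : I.Admissible) (h1 : I.CyclePreventionI)
    (h2 : I.CyclePreventionII) {P : Route m} (hP : I.Feasible P) :
    ∃ Q, I.Feasible Q ∧ Q.length < n ∧ I.totalFuel Q ≤ I.totalFuel P := by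
  induction hk : P.length using Nat.strong_induction_on generalizing P with
  | _ k ih =>
    rcases exists_cycle_or_nodup hP.1 with ⟨A, C, R, rfl, hC⟩ | hnd
    · obtain ⟨Q, hQ, hl, hf⟩ := hI.exists_remove_cycle h1 h2 hC hP
      obtain ⟨Q', hQ', hl', hf'⟩ := ih _ (hk ▸ hl) hQ rfl
      exact ⟨Q', hQ', hl', hf'.trans hf⟩
    · refine ⟨P, hP, ?_, le_rfl⟩
      have := hnd.length_le_card
      simp only [List.length_cons, List.length_map, Fintype.card_fin] at this
      omega

/-! ### The inverse operations -/

/-- The machine only returns a supremum. It is attained because the set is compact by continuity,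
and nonempty by `h`. -/
theorem Admissible.isGreatest_fuel (hI : I.Admissible) {e : Fin m} {y : ℝ} (h : I.fuel e 0 ≤ y) :
    IsGreatest {a | a ∈ Set.Icc (0 : ℝ) 1 ∧ I.fuel e a ≤ y}
      (sSup {a | a ∈ Set.Icc (0 : ℝ) 1 ∧ I.fuel e a ≤ y}) := by
  have hcl : IsClosed {a | a ∈ Set.Icc (0 : ℝ) 1 ∧ I.fuel e a ≤ y} :=
    (hI.fuel_diff e).continuousOn.preimage_isClosed_of_isClosed isClosed_Icc isClosed_Iic
  exact (isCompact_Icc.of_isClosed_subset hcl fun a ha => ha.1).isGreatest_sSup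
    ⟨0, ⟨le_rfl, zero_le_one⟩, h⟩

theorem Admissible.isGreatest_batt (hI : I.Admissible) {e : Fin m} {y z : ℝ}
    (hz : z ∈ Set.Icc (0 : ℝ) 1) (h : y ≤ I.batt e z) :
    IsGreatest {a | a ∈ Set.Icc (0 : ℝ) 1 ∧ y ≤ I.batt e a}
      (sSup {a | a ∈ Set.Icc (0 : ℝ) 1 ∧ y ≤ I.batt e a}) := by
  have hcl : IsClosed {a | a ∈ Set.Icc (0 : ℝ) 1 ∧ y ≤ I.batt e a} :=
    (hI.batt_diff e).continuousOn.preimage_isClosed_of_isClosed isClosed_Icc isClosed_Ici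
  exact (isCompact_Icc.of_isClosed_subset hcl fun a ha => ha.1).isGreatest_sSup ⟨z, hz, h⟩

/-! ### Positive optima are bounded away from zero -/

/-- Slightly to the right of z, at x, the battery consumption has hardly dropped but the fuel is
already positive. By monotonicity, any parameter with at most half that fuel lies left of x. -/
theorem Admissible.exists_gap (hI : I.Admissible) {e : Fin m} {z κ : ℝ}
    (hz : IsGreatest {a | a ∈ Set.Icc (0 : ℝ) 1 ∧ I.fuel e a ≤ 0} z) (hκ : 0 < κ) :
    ∃ η > 0, ∀ a ∈ Set.Icc (0 : ℝ) 1, I.fuel e a ≤ η → I.batt e z - κ ≤ I.batt e a := by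
  rcases hz.1.1.2.eq_or_lt with h1 | h1
  · refine ⟨1, one_pos, fun a ha _ => ?_⟩
    have := hI.batt_anti e ha hz.1.1 (h1 ▸ ha.2)
    linarith
  · obtain ⟨δ, hδ, hb⟩ := Metric.continuousWithinAt_iff.1
      ((hI.batt_diff e).continuousOn z hz.1.1) κ hκ
    have hzx : z < min 1 (z + δ / 2) := lt_min h1 (by linarith)
    set x := min 1 (z + δ / 2) with hxdef
    have hx : x ∈ Set.Icc (0 : ℝ) 1 := ⟨hz.1.1.1.trans hzx.le, min_le_left _ _⟩
    have hfx : 0 < I.fuel e x := by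
      by_contra! h
      exact absurd (hz.2 ⟨hx, h⟩) (not_le.2 hzx)
    have hbx := hb hx (by
      rw [Real.dist_eq, abs_of_pos (by linarith)]
      have : x ≤ z + δ / 2 := min_le_right _ _
      linarith)
    rw [Real.dist_eq, abs_lt] at hbx
    refine ⟨I.fuel e x / 2, by linarith, fun a ha hfa => ?_⟩
    have hax : a ≤ x := by
      by_contra! h
      have := hI.fuel_mono e hx ha h.le
      linarith
    have := hI.batt_anti e ha hx hax
    linarith [hbx.1]

/-- A compactness argument along a fixed edge sequence: if the infimum of the fuel is zero, it is
attained. The first edge is driven with its largest fuel-free parameter, lowered if the capacity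
demands it. By `Admissible.exists_gap`, nearly fuel-free routes leave that edge with hardly more
charge. The slack η in the initial charge is what lets this pass to the tail. -/
theorem Admissible.exists_zero_of_forall_le (hI : I.Admissible) (h1 : I.CyclePreventionI)
    (es : List (Fin m)) {u v : Fin n} {b' : ℝ} (hb' : b' ∈ Set.Icc 0 I.cap)
    (h : ∀ η > 0, ∃ (Q : Route m) (b : ℝ), Q.map Prod.fst = es ∧ I.IsPath u v Q ∧ b ≤ b' + η ∧
      I.ChargeOK b Q ∧ I.totalFuel Q ≤ η) :
    ∃ Q : Route m, I.IsPath u v Q ∧ I.ChargeOK b' Q ∧ I.totalFuel Q ≤ 0 := by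
  induction es generalizing u b' with
  | nil =>
    obtain ⟨Q, b, hQ, hp, -⟩ := h 1 one_pos
    obtain rfl := List.map_eq_nil_iff.1 hQ
    exact ⟨[], hp, trivial, le_rfl⟩
  | cons e es ih =>
    have hf0 : I.fuel e 0 ≤ 0 := by
      refine le_of_forall_pos_le_add fun η hη => ?_
      obtain ⟨Q, b, hQ, hp, -, -, hf⟩ := h η hη
      obtain ⟨p, Q, rfl, rfl, -⟩ := List.map_eq_cons_iff.1 hQ
      have := hI.fuel_le_totalFuel hp.param_mem (List.mem_cons_self (a := p) (l := Q))
      have := hI.fuel_mono p.1 ⟨le_rfl, zero_le_one⟩ hp.2.1 hp.2.1.1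
      linarith
    have hz := hI.isGreatest_fuel hf0
    set z := sSup {a | a ∈ Set.Icc (0 : ℝ) 1 ∧ I.fuel e a ≤ 0}
    obtain ⟨x, hx, hxz, hxe⟩ := hI.exists_clamp h1 e hz.1.1 hb'.2
    have key : ∀ η > 0, ∃ (p : Fin m × ℝ) (Q : Route m) (b : ℝ), p.1 = e ∧ Q.map Prod.fst = es ∧
        I.IsPath u v (p :: Q) ∧ b - I.batt e p.2 ≤ b' - I.batt e x + η ∧
        I.ChargeOK b (p :: Q) ∧ I.totalFuel (p :: Q) ≤ η := by
      intro η hη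
      obtain ⟨η', hη', hg⟩ := hI.exists_gap hz (half_pos hη)
      obtain ⟨Q, b, hQ, hp, hb, hc, hf⟩ := h (min η' (η / 2)) (lt_min hη' (half_pos hη))
      obtain ⟨p, Q, rfl, rfl, hQ'⟩ := List.map_eq_cons_iff.1 hQ
      have h3 := min_le_left η' (η / 2)
      have h4 := min_le_right η' (η / 2)
      refine ⟨p, Q, b, rfl, hQ', hp, ?_, hc, by linarith⟩
      have h5 := hI.fuel_le_totalFuel hp.param_mem (List.mem_cons_self (a := p) (l := Q))
      have h6 := hg p.2 hp.2.1 (by linarith)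
      rw [hxe, ← min_add_add_right]
      exact le_min (by linarith [hc.1.2]) (by linarith)
    have hx0 : 0 ≤ b' - I.batt e x := by
      refine le_of_forall_pos_le_add fun η hη => ?_
      obtain ⟨p, Q, b, rfl, -, -, hb, hc, -⟩ := key η hη
      exact hc.1.1.trans hb
    have hu : I.src e = u := by
      obtain ⟨p, Q, b, rfl, -, hp, -⟩ := key 1 one_pos
      exact hp.1
    obtain ⟨Q, hQ, hQc, hQf⟩ := ih (u := I.tgt e) (b' := b' - I.batt e x)
      ⟨hx0, by rw [hxe]; exact min_le_left _ _⟩ fun η hη => by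
        obtain ⟨p, Q, b, rfl, hQ, hp, hb, hc, hf⟩ := key η hη
        refine ⟨Q, b - I.batt p.1 p.2, hQ, hp.2.2, hb, hc.2, ?_⟩
        rw [totalFuel_cons] at hf
        linarith [hI.fuel_nonneg p.1 p.2 hp.2.1]
    refine ⟨(e, x) :: Q, ⟨hu, hx, hQ⟩, ⟨⟨hx0, by simp only [hxe]; exact min_le_left _ _⟩, hQc⟩, ?_⟩
    have := hI.fuel_mono e hx hz.1.1 hxz
    have := hz.1.2
    rw [totalFuel_cons]
    dsimp only
    linarith

/-- Total fuel consumption of all edges at full power. -/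
def fullFuel (I : Instance n m) : ℝ := ∑ e, I.fuel e 1

theorem Admissible.fuel_le_fullFuel (hI : I.Admissible) (e : Fin m) {a : ℝ}
    (ha : a ∈ Set.Icc (0 : ℝ) 1) : I.fuel e a ≤ I.fullFuel :=
  (hI.fuel_mono e ha ⟨zero_le_one, le_rfl⟩ ha.2).trans
    (Finset.single_le_sum (f := fun e => I.fuel e 1)
      (fun e _ => hI.fuel_nonneg e 1 ⟨zero_le_one, le_rfl⟩) (Finset.mem_univ e))

theorem Admissible.fullFuel_nonneg (hI : I.Admissible) : 0 ≤ I.fullFuel :=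
  Finset.sum_nonneg fun e _ => hI.fuel_nonneg e 1 ⟨zero_le_one, le_rfl⟩

/-- For each edge sequence a positive lower bound exists, since an infimum of zero would be
attained. By `Admissible.exists_short` only the finitely many sequences of fewer than n edges
matter. -/
theorem Admissible.exists_pos_le_totalFuel (hI : I.Admissible) (h1 : I.CyclePreventionI)
    (h2 : I.CyclePreventionII) (h0 : ∀ Q, I.Feasible Q → 0 < I.totalFuel Q) :
    ∃ c > 0, ∀ Q, I.Feasible Q → c ≤ I.totalFuel Q := by
  have hes : ∀ es : List (Fin m), ∃ c > 0, ∀ Q : Route m, Q.map Prod.fst = es → I.Feasible Q →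
      c ≤ I.totalFuel Q := by
    intro es
    by_contra! h
    obtain ⟨Q, hQ, hc, hf⟩ := hI.exists_zero_of_forall_le h1 es (u := I.s) (v := I.t)
      hI.charge_mem fun η hη => by
        obtain ⟨Q, hQe, hQ, hf⟩ := h η hη
        exact ⟨Q, I.B₀, hQe, hQ.1, by linarith, hQ.2, hf.le⟩
    exact absurd (h0 Q ⟨hQ, hc⟩) (not_lt.2 hf)
  choose c hc0 hc using hes
  have hfin : {l : List (Fin m) | l.length < n}.Finite := List.finite_length_lt _ _
  obtain ⟨d, hd, hd'⟩ : ∃ d > 0, ∀ l ∈ hfin.toFinset, d ≤ c l := by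
    induction hfin.toFinset using Finset.induction_on with
    | empty => exact ⟨1, one_pos, by simp⟩
    | insert a s _ ih =>
      obtain ⟨d, hd, hd'⟩ := ih
      refine ⟨min d (c a), lt_min hd (hc0 a), fun l hl => ?_⟩
      rcases Finset.mem_insert.1 hl with rfl | hl
      · exact min_le_right _ _
      · exact (min_le_left _ _).trans (hd' l hl)
  refine ⟨d, hd, fun Q hQ => ?_⟩
  obtain ⟨P, hP, hl, hf⟩ := hI.exists_short h1 h2 hQ
  exact (hd' _ (by simpa using hl)).trans ((hc _ P rfl hP).trans hf)

/-- This makes the program halt on every instance, without any assumption on the range of the fuel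
values. -/
theorem Admissible.exists_fuelRange (hI : I.Admissible) (h1 : I.CyclePreventionI)
    (h2 : I.CyclePreventionII) : ∃ L, I.FuelRange L := by
  by_cases h0 : ∃ Q, I.Feasible Q ∧ I.totalFuel Q = 0
  · exact ⟨0, Or.inl h0⟩
  · push Not at h0
    obtain ⟨c, hc, hcQ⟩ := hI.exists_pos_le_totalFuel h1 h2 fun Q hQ =>
      lt_of_le_of_ne (hI.totalFuel_nonneg hQ.1.param_mem) (h0 Q hQ).symm
    obtain ⟨L, hL⟩ := pow_unbounded_of_one_lt (I.fullFuel / c) (one_lt_two)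
    refine ⟨L, Or.inr fun Q hQ e a ha => (hI.fuel_le_fullFuel e ha).trans ?_⟩
    rw [div_lt_iff₀ hc] at hL
    exact hL.le.trans (mul_le_mul_of_nonneg_left (hcQ Q hQ) (by positivity))

/-! ### The range of linear consumption functions -/

/-- A quantitative counterpart of `Admissible.exists_zero_of_forall_le`. The charges of the
constructed fuel-free route are multiples of 1/N. The given route is ahead of it by at most g plus C
times the fuel it has used, which is less than 1/N. The lead g grows along the induction. -/
theorem Admissible.exists_zero_of_grid (hI : I.Admissible) (h1 : I.CyclePreventionI) {N C η : ℝ}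
    (hN : 0 < N) (hC : 0 ≤ C)
    (hzero : ∀ e, ∀ a ∈ Set.Icc (0 : ℝ) 1, I.fuel e a ≤ η → ∃ z ∈ Set.Icc (0 : ℝ) 1,
      I.fuel e z ≤ 0 ∧ (∃ k : ℤ, N * I.batt e z = k) ∧ I.batt e z - I.batt e a ≤ C * I.fuel e a)
    (hcap : ∃ k : ℤ, N * I.cap = k) {Q : Route m} {u v : Fin n} {b b' g : ℝ}
    (hQ : I.IsPath u v Q) (hc : I.ChargeOK b Q) (hb' : b' ∈ Set.Icc 0 I.cap)
    (hb'k : ∃ k : ℤ, N * b' = k) (hbg : b ≤ b' + g) (hg : 0 ≤ g)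
    (hf : I.totalFuel Q ≤ η) (hgη : N * (g + C * I.totalFuel Q) < 1) :
    ∃ Q : Route m, I.IsPath u v Q ∧ I.ChargeOK b' Q ∧ I.totalFuel Q ≤ 0 := by
  induction Q generalizing u b b' g with
  | nil => exact ⟨[], hQ, trivial, le_rfl⟩
  | cons p Q ih =>
    have hfp := hI.fuel_nonneg p.1 p.2 hQ.2.1
    have hfQ := hI.totalFuel_nonneg hQ.2.2.param_mem
    rw [totalFuel_cons] at hf hgη
    obtain ⟨z, hz, hz0, ⟨k, hk⟩, hzC⟩ := hzero p.1 p.2 hQ.2.1 (by linarith)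
    obtain ⟨x, hx, hxz, hxe⟩ := hI.exists_clamp h1 p.1 hz hb'.2
    obtain ⟨kc, hkc⟩ := hcap
    obtain ⟨kb, hkb⟩ := hb'k
    have hgrid : ∃ k : ℤ, N * (b' - I.batt p.1 x) = k := by
      rw [hxe]
      rcases min_choice I.cap (b' - I.batt p.1 z) with h | h <;> rw [h]
      · exact ⟨kc, hkc⟩
      · exact ⟨kb - k, by push_cast; linarith⟩
    have hCf := mul_nonneg hC hfp
    have hCQ := mul_nonneg hC hfQ
    have hb1 : b - I.batt p.1 p.2 ≤ b' - I.batt p.1 x + (g + C * I.fuel p.1 p.2) := by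
      rw [hxe, ← min_add_add_right]
      exact le_min (by linarith [hc.1.2]) (by linarith)
    -- The given route has nonnegative charge, so this charge exceeds -1/N; a multiple of 1/N above
    -- -1/N is nonnegative.
    have hx0 : 0 ≤ b' - I.batt p.1 x := by
      obtain ⟨j, hj⟩ := hgrid
      have h3 : N * (b' - I.batt p.1 x + (g + C * I.fuel p.1 p.2)) ≥ 0 :=
        mul_nonneg hN.le (hc.1.1.trans hb1)
      have h4 : N * (C * I.totalFuel Q) ≥ 0 := mul_nonneg hN.le hCQ
      have h5 : (-1 : ℝ) < j := by rw [← hj]; nlinarith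
      have h6 : (0 : ℝ) ≤ j := by
        have : (-1 : ℤ) < j := by exact_mod_cast h5
        exact_mod_cast (by omega : (0 : ℤ) ≤ j)
      rw [← hj] at h6
      exact nonneg_of_mul_nonneg_right h6 hN
    obtain ⟨R, hR, hRc, hRf⟩ := ih hQ.2.2 hc.2
      (b' := b' - I.batt p.1 x) ⟨hx0, by rw [hxe]; exact min_le_left _ _⟩ hgrid hb1
      (by linarith) (by linarith) (by linarith)
    refine ⟨(p.1, x) :: R, ⟨hQ.1, hx, hR⟩,
      ⟨⟨hx0, by simp only [hxe]; exact min_le_left _ _⟩, hRc⟩, ?_⟩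
    have := hI.fuel_mono p.1 hx hz hxz
    rw [totalFuel_cons]
    dsimp only
    linarith

end Instance

theorem abs_le_two_pow_bitLength (q : ℚ) : |(q : ℝ)| ≤ 2 ^ Nat.size q.num.natAbs := by
  have h1 : |(q : ℝ)| ≤ |(q.num : ℝ)| := by
    conv_lhs => rw [← Rat.num_div_den q]
    push_cast
    rw [abs_div, Nat.abs_cast]
    exact div_le_self (abs_nonneg _) (by exact_mod_cast q.pos)
  have h2 : |(q.num : ℝ)| = (q.num.natAbs : ℝ) := by
    rw [Nat.cast_natAbs, Int.cast_abs]
  rw [h2] at h1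
  exact h1.trans (by exact_mod_cast (Nat.lt_size_self _).le)

theorem den_le_two_pow_size (q : ℚ) : (q.den : ℝ) ≤ 2 ^ Nat.size q.den := by
  exact_mod_cast (Nat.lt_size_self _).le

theorem inv_den_le_of_pos {q : ℚ} (hq : 0 < q) : 1 ≤ (q : ℝ) * q.den := by
  have h : (q : ℝ) * q.den = (q.num : ℝ) := by exact_mod_cast Rat.mul_den_eq_num q
  rw [h]
  exact_mod_cast Rat.num_pos.2 hq

theorem exists_int_of_den_dvd {q : ℚ} {N : ℕ} (h : q.den ∣ N) : ∃ k : ℤ, (N : ℝ) * q = k := by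
  obtain ⟨c, rfl⟩ := h
  refine ⟨c * q.num, ?_⟩
  have h : (q : ℝ) * q.den = (q.num : ℝ) := by exact_mod_cast Rat.mul_den_eq_num q
  push_cast
  rw [← h]; ring

namespace LinearData

variable {n m : ℕ} {I : Instance n m} (D : LinearData m)

theorem bitLength_edge_le (e : Fin m) :
    HybridRouting.bitLength (D.fuel₀ e) + HybridRouting.bitLength (D.fuel₁ e) +
    HybridRouting.bitLength (D.batt₀ e) + HybridRouting.bitLength (D.batt₁ e) ≤ D.bitLength := by
  have := Finset.single_le_sum (f := fun e =>
    HybridRouting.bitLength (D.fuel₀ e) + HybridRouting.bitLength (D.fuel₁ e) +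
    HybridRouting.bitLength (D.batt₀ e) + HybridRouting.bitLength (D.batt₁ e))
    (fun _ _ => Nat.zero_le _) (Finset.mem_univ e)
  rw [LinearData.bitLength]
  omega

/-- A common denominator of the data concerning charges. -/
def commonDen : ℕ := (∏ e, ((D.batt₀ e).den * (D.batt₁ e).den)) * D.B₀.den * D.cap.den

theorem commonDen_le : (D.commonDen : ℝ) ≤ 2 ^ D.bitLength := by
  have h : D.commonDen ≤ (∏ e, 2 ^ (Nat.size (D.batt₀ e).den + Nat.size (D.batt₁ e).den)) *
      2 ^ Nat.size D.B₀.den * 2 ^ Nat.size D.cap.den := by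
    unfold commonDen
    gcongr with e
    · rw [pow_add]
      exact Nat.mul_le_mul (Nat.lt_size_self _).le (Nat.lt_size_self _).le
    · exact (Nat.lt_size_self _).le
    · exact (Nat.lt_size_self _).le
  rw [Finset.prod_pow_eq_pow_sum, ← pow_add, ← pow_add] at h
  refine le_trans (b := ((2 ^ _ : ℕ) : ℝ)) (by exact_mod_cast h) ?_
  push_cast
  refine pow_le_pow_right₀ one_le_two ?_
  rw [LinearData.bitLength]
  simp only [HybridRouting.bitLength]
  gcongr <;> omega

variable {D}

/-- Fuel values are at most 2^(l+1), and a positive optimum is at least 2^(-(2l+1)), whence the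
exponent 3l + 2. The lower bound comes from the grid lemma with N and C at most 2^l: a cheaper
feasible path would satisfy N · C · fuel < 1 and so yield a fuel-free one. -/
theorem Represents.fuelRange (hD : D.Represents I) (hI : I.Admissible)
    (h1 : I.CyclePreventionI) : I.FuelRange (3 * D.bitLength + 2) := by
  set l := D.bitLength with hl
  have m0 : (0 : ℝ) ∈ Set.Icc (0 : ℝ) 1 := ⟨le_rfl, zero_le_one⟩
  have m1 : (1 : ℝ) ∈ Set.Icc (0 : ℝ) 1 := ⟨zero_le_one, le_rfl⟩
  have hp : ∀ e, (0 : ℚ) ≤ D.fuel₀ e := fun e => by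
    have := hI.fuel_nonneg e 0 m0
    rw [(hD.1 e 0 m0).1] at this
    exact_mod_cast (by simpa using this : (0 : ℝ) ≤ D.fuel₀ e)
  have hq : ∀ e, (0 : ℚ) ≤ D.fuel₁ e := fun e => by
    have := hI.fuel_mono e m0 m1 zero_le_one
    rw [(hD.1 e 0 m0).1, (hD.1 e 1 m1).1] at this
    exact_mod_cast (by simpa using this : (0 : ℝ) ≤ D.fuel₁ e)
  have two : (1 : ℝ) ≤ 2 := one_le_two
  by_cases h0 : ∃ Q, I.Feasible Q ∧ I.totalFuel Q ≤ 0
  · obtain ⟨Q, hQ, hf⟩ := h0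
    exact Or.inl ⟨Q, hQ, hf.antisymm (hI.totalFuel_nonneg hQ.1.param_mem)⟩
  refine Or.inr fun Q hQ e a ha => ?_
  have hfe : I.fuel e a ≤ 2 ^ (l + 1) := by
    have h3 := abs_le_two_pow_bitLength (D.fuel₀ e)
    have h4 := abs_le_two_pow_bitLength (D.fuel₁ e)
    have h5 : (D.fuel₁ e : ℝ) * a ≤ |(D.fuel₁ e : ℝ)| :=
      (mul_le_of_le_one_right (by exact_mod_cast hq e) ha.2).trans (le_abs_self _)
    have h6 := D.bitLength_edge_le e
    simp only [HybridRouting.bitLength] at h6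
    have h7 : (2 : ℝ) ^ Nat.size (D.fuel₀ e).num.natAbs ≤ 2 ^ l :=
      pow_le_pow_right₀ two (by omega)
    have h8 : (2 : ℝ) ^ Nat.size (D.fuel₁ e).num.natAbs ≤ 2 ^ l :=
      pow_le_pow_right₀ two (by omega)
    rw [(hD.1 e a ha).1, pow_succ]
    linarith [le_abs_self (D.fuel₀ e : ℝ)]
  have hQf : 1 ≤ 2 ^ (2 * l + 1) * I.totalFuel Q := by
    by_contra! hlt
    refine h0 ?_
    have hd : 0 < (D.commonDen : ℝ) := by
      unfold commonDen
      have : 0 < ∏ e, ((D.batt₀ e).den * (D.batt₁ e).den) :=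
        Finset.prod_pos fun e _ => Nat.mul_pos (D.batt₀ e).pos (D.batt₁ e).pos
      exact_mod_cast Nat.mul_pos (Nat.mul_pos this D.B₀.pos) D.cap.pos
    have hfQ := hI.totalFuel_nonneg hQ.1.param_mem
    have hdvd : ∀ e, (D.batt₀ e).den * (D.batt₁ e).den ∣ D.commonDen := fun e =>
      Dvd.dvd.mul_right (Dvd.dvd.mul_right (Finset.dvd_prod_of_mem _ (Finset.mem_univ e)) _) _
    suffices h : ∃ R : Route m, I.IsPath I.s I.t R ∧ I.ChargeOK I.B₀ R ∧ I.totalFuel R ≤ 0 by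
      obtain ⟨R, hR, hRc, hRf⟩ := h
      exact ⟨R, ⟨hR, hRc⟩, hRf⟩
    refine hI.exists_zero_of_grid h1 (N := D.commonDen) (C := 2 ^ l)
      (η := I.totalFuel Q) hd (by positivity) ?_ ?_ hQ.1 hQ.2 hI.charge_mem ?_
      (by simp) le_rfl le_rfl ?_
    · intro e a ha hfa
      have h6 := D.bitLength_edge_le e
      simp only [HybridRouting.bitLength] at h6
      have ea := hD.1 e a ha
      -- A positive constant term is at least the reciprocal of its denominator, too much for so
      -- cheap a path.
      have hp0 : D.fuel₀ e = 0 := by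
        by_contra hne
        have h3 := inv_den_le_of_pos (lt_of_le_of_ne (hp e) (Ne.symm hne))
        have h4 : ((D.fuel₀ e).den : ℝ) ≤ 2 ^ (2 * l + 1) :=
          (den_le_two_pow_size _).trans (pow_le_pow_right₀ two (by omega))
        have h5 : (D.fuel₀ e : ℝ) ≤ I.fuel e a := by
          rw [ea.1]
          linarith [mul_nonneg (by exact_mod_cast hq e : (0 : ℝ) ≤ D.fuel₁ e) ha.1]
        have h7 : (0 : ℝ) ≤ D.fuel₀ e := by exact_mod_cast hp e
        have h8 : (D.fuel₀ e : ℝ) * (D.fuel₀ e).den ≤ I.totalFuel Q * 2 ^ (2 * l + 1) :=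
          mul_le_mul (h5.trans hfa) h4 (by positivity) hfQ
        linarith
      obtain ⟨k₀, hk₀⟩ := exists_int_of_den_dvd ((Dvd.intro _ rfl).trans (hdvd e))
      obtain ⟨k₁, hk₁⟩ := exists_int_of_den_dvd ((Dvd.intro_left _ rfl).trans (hdvd e))
      -- If the slope is zero, all parameters are fuel-free and 1 is best for the battery. Otherwise
      -- only 0 is fuel-free, and moving from a to 0 loses at most |w| a ≤ 2^l q a of charge, with w
      -- and q the battery and fuel slopes.
      rcases eq_or_lt_of_le (hq e) with hq0 | hq0
      · refine ⟨1, m1, ?_, ⟨k₀ + k₁, ?_⟩, ?_⟩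
        · rw [(hD.1 e 1 m1).1, hp0, ← hq0]; simp
        · rw [(hD.1 e 1 m1).2]; push_cast; linarith
        · have := hI.batt_anti e ha m1 ha.2
          have := hI.fuel_nonneg e a ha
          have : 0 ≤ 2 ^ l * I.fuel e a := by positivity
          linarith
      · refine ⟨0, m0, ?_, ⟨k₀, ?_⟩, ?_⟩
        · rw [(hD.1 e 0 m0).1, hp0]; simp
        · rw [(hD.1 e 0 m0).2]; simpa using hk₀
        · rw [(hD.1 e 0 m0).2, ea.2, ea.1, hp0]
          have h3 := inv_den_le_of_pos hq0
          have h4 : ((D.fuel₁ e).den : ℝ) ≤ 2 ^ Nat.size (D.fuel₁ e).den := den_le_two_pow_size _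
          have h5 := abs_le_two_pow_bitLength (D.batt₁ e)
          have h7 : (0 : ℝ) ≤ D.fuel₁ e := by exact_mod_cast hq0.le
          have h8 : |(D.batt₁ e : ℝ)| ≤ 2 ^ l * D.fuel₁ e := by
            calc |(D.batt₁ e : ℝ)| ≤ 2 ^ Nat.size (D.batt₁ e).num.natAbs * 1 := by linarith
              _ ≤ 2 ^ Nat.size (D.batt₁ e).num.natAbs *
                  (D.fuel₁ e * 2 ^ Nat.size (D.fuel₁ e).den) := by
                gcongr
                exact h3.trans (mul_le_mul_of_nonneg_left h4 h7)
              _ = 2 ^ (Nat.size (D.batt₁ e).num.natAbs + Nat.size (D.fuel₁ e).den) *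
                  D.fuel₁ e := by rw [pow_add]; ring
              _ ≤ 2 ^ l * D.fuel₁ e := by
                gcongr
                · omega
          have h9 : -(D.batt₁ e : ℝ) * a ≤ 2 ^ l * D.fuel₁ e * a :=
            mul_le_mul_of_nonneg_right ((neg_le_abs _).trans h8) ha.1
          push_cast
          linarith
    · rw [hD.2.2]
      exact exists_int_of_den_dvd (Dvd.intro_left _ rfl)
    · rw [hD.2.1]
      exact exists_int_of_den_dvd ((Dvd.intro_left _ rfl).trans (Dvd.intro _ rfl))
    · have h3 : (D.commonDen : ℝ) * (0 + 2 ^ l * I.totalFuel Q) ≤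
          2 ^ l * (0 + 2 ^ l * I.totalFuel Q) :=
        mul_le_mul_of_nonneg_right D.commonDen_le (by positivity)
      have h4 : (2 : ℝ) ^ (2 * l + 1) * I.totalFuel Q =
          2 * (2 ^ l * (2 ^ l * I.totalFuel Q)) := by ring
      have h5 : 0 ≤ (2 : ℝ) ^ l * (2 ^ l * I.totalFuel Q) := by positivity
      rw [zero_add] at h3 ⊢
      linarith
  calc I.fuel e a ≤ 2 ^ (l + 1) * 1 := by linarith
    _ ≤ 2 ^ (l + 1) * (2 ^ (2 * l + 1) * I.totalFuel Q) := by gcongr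
    _ = 2 ^ (3 * l + 2) * I.totalFuel Q := by ring

end LinearData
namespace Instance

variable {n m : ℕ} {I : Instance n m}

/-! ### Driving an edge with bounded fuel -/

/-- The largest strategy parameter on `e` that consumes fuel at most `y` and, with initial charge
`b`, obeys the battery capacity. -/
noncomputable def driveParam (I : Instance n m) (b : ℝ) (e : Fin m) (y : ℝ) : ℝ :=
  min (sSup {a | a ∈ Set.Icc (0 : ℝ) 1 ∧ I.fuel e a ≤ y})
    (sSup {a | a ∈ Set.Icc (0 : ℝ) 1 ∧ b - I.cap ≤ I.batt e a})

theorem Admissible.isGreatest_cap (hI : I.Admissible) (h1 : I.CyclePreventionI) {b : ℝ}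
    (hb : b ≤ I.cap) (e : Fin m) :
    IsGreatest {a | a ∈ Set.Icc (0 : ℝ) 1 ∧ b - I.cap ≤ I.batt e a}
      (sSup {a | a ∈ Set.Icc (0 : ℝ) 1 ∧ b - I.cap ≤ I.batt e a}) := by
  obtain ⟨z, hz, hz0⟩ := h1 e
  exact hI.isGreatest_batt hz (by linarith)

theorem Admissible.driveParam_mem (hI : I.Admissible) (h1 : I.CyclePreventionI) {b : ℝ}
    (hb : b ≤ I.cap) (e : Fin m) (y : ℝ) : I.driveParam b e y ∈ Set.Icc (0 : ℝ) 1 := by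
  have h := (hI.isGreatest_cap h1 hb e).1.1
  refine ⟨le_min ?_ h.1, (min_le_right _ _).trans h.2⟩
  -- If the budget y is below every fuel value, the supremum is that of the empty set, namely 0,
  -- which is still a valid parameter.
  exact Real.sSup_nonneg fun a ha => ha.1.1

theorem Admissible.driveParam_le_cap (hI : I.Admissible) (h1 : I.CyclePreventionI) {b : ℝ}
    (hb : b ≤ I.cap) (e : Fin m) (y : ℝ) : b - I.batt e (I.driveParam b e y) ≤ I.cap := by
  have h := (hI.isGreatest_cap h1 hb e).1
  have := hI.batt_anti e (hI.driveParam_mem h1 hb e y) h.1 (min_le_right _ _)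
  linarith [h.2]

/-- The dominance principle behind keeping a single label per node and level. The parameter a,
lowered to fit the capacity from charge b, competes in both suprema defining `driveParam`, and a
larger parameter leaves more charge. -/
theorem Admissible.driveParam_optimal (hI : I.Admissible) (h1 : I.CyclePreventionI) {b b' a y : ℝ}
    {e : Fin m} (hb : b ≤ I.cap) (hb' : b' ≤ b) (ha : a ∈ Set.Icc (0 : ℝ) 1)
    (hf : I.fuel e a ≤ y) (hc : b' - I.batt e a ≤ I.cap) :
    I.fuel e (I.driveParam b e y) ≤ y ∧
      b' - I.batt e a ≤ b - I.batt e (I.driveParam b e y) := by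
  have h0 : I.fuel e 0 ≤ y := (hI.fuel_mono e ⟨le_rfl, zero_le_one⟩ ha ha.1).trans hf
  have hg := hI.isGreatest_fuel h0
  have hx := hI.driveParam_mem h1 hb e y
  have hm := hI.isGreatest_cap h1 hb e
  refine ⟨(hI.fuel_mono e hx hg.1.1 (min_le_left _ _)).trans hg.1.2, ?_⟩
  obtain ⟨x, hx', hxa, hxe⟩ := hI.exists_clamp h1 e ha hb
  have hle : x ≤ I.driveParam b e y := by
    refine le_min (hxa.trans (hg.2 ⟨ha, hf⟩)) (hm.2 ⟨hx', ?_⟩)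
    have := min_le_left I.cap (b - I.batt e a)
    linarith
  have h3 := hI.batt_anti e hx' hx hle
  have h4 : b' - I.batt e a ≤ b - I.batt e x := by
    rw [hxe]; exact le_min hc (by linarith)
  linarith

end Instance

/-! ### Reasoning about programs -/

variable {n m : ℕ} {I : Instance n m}

/-- Started in `σ`, the program halts after at most `T` steps in a memory with property `Q`. -/
def WP (I : Instance n m) (c : Program) (Q : Memory → Prop) (T : ℕ) (σ : Memory) : Prop :=
  ∃ τ t, Exec I c σ τ t ∧ t ≤ T ∧ Q τ

def Op.natDst : Op → List ℕ
  | natConst x _ | natAdd x _ _ | natSub x _ _ | natLoad x _ _ | edgeSrc x _ | edgeTgt x _ => [x]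
  | _ => []

def Op.realDst : Op → List ℕ
  | realConst x _ | realAdd x _ _ | realSub x _ _ | realMul x _ _ | realDiv x _ _
  | realLoad x _ _ | evalFuel x _ _ | evalBatt x _ _ | invFuel x _ _ | invBatt x _ _ => [x]
  | _ => []

def Op.natArrDst : Op → List ℕ
  | natStore arr _ _ => [arr]
  | _ => []

def Op.realArrDst : Op → List ℕ
  | realStore arr _ _ => [arr]
  | _ => []

namespace Program

/-- The union of the lists `f o` over all operations `o` of a program. -/
def collect (f : Op → List ℕ) : Program → List ℕ
  | op o => f o
  | seq c d => c.collect f ++ d.collect f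
  | cond _ c d => c.collect f ++ d.collect f
  | loop _ c => c.collect f

/-- Some operations, followed by a program. -/
def pre (os : List Op) (c : Program) : Program := os.foldr (fun o c => seq (op o) c) c

/-- An idle step (register `24` is a scratch register). -/
def skip : Program := op (.natConst 24 0)

/-- `for x := 0, …, y - 1` (register `5` holds the number `1`). -/
def forLoop (x y : ℕ) (c : Program) : Program :=
  seq (op (.natConst x 0)) (loop (.natLt x y) (seq c (op (.natAdd x x 5))))

end Program

/-- The memory `τ` differs from `σ` only in places that `c` writes to. -/
structure Frame (c : Program) (σ τ : Memory) : Prop where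
  nat : ∀ x, x ∉ c.collect Op.natDst → τ.nat x = σ.nat x
  real : ∀ x, x ∉ c.collect Op.realDst → τ.real x = σ.real x
  natArr : ∀ x, x ∉ c.collect Op.natArrDst → τ.natArr x = σ.natArr x
  realArr : ∀ x, x ∉ c.collect Op.realArrDst → τ.realArr x = σ.realArr x

theorem Frame.refl (c : Program) (σ : Memory) : Frame c σ σ :=
  ⟨fun _ _ => rfl, fun _ _ => rfl, fun _ _ => rfl, fun _ _ => rfl⟩

theorem Frame.trans {c : Program} {σ τ ρ : Memory} (h : Frame c σ τ) (h' : Frame c τ ρ) :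
    Frame c σ ρ :=
  ⟨fun x hx => (h'.nat x hx).trans (h.nat x hx), fun x hx => (h'.real x hx).trans (h.real x hx),
    fun x hx => (h'.natArr x hx).trans (h.natArr x hx),
    fun x hx => (h'.realArr x hx).trans (h.realArr x hx)⟩

theorem Frame.mono {c d : Program} {σ τ : Memory} (h : Frame c σ τ)
    (hcd : ∀ f x, x ∈ c.collect f → x ∈ d.collect f) : Frame d σ τ :=
  ⟨fun x hx => h.nat x fun h' => hx (hcd _ x h'), fun x hx => h.real x fun h' => hx (hcd _ x h'),
    fun x hx => h.natArr x fun h' => hx (hcd _ x h'),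
    fun x hx => h.realArr x fun h' => hx (hcd _ x h')⟩

theorem Frame.op (o : Op) (σ : Memory) : Frame (.op o) σ (o.apply I σ) := by
  constructor <;> intro x hx <;> cases o <;>
    simp_all [Program.collect, Op.natDst, Op.realDst, Op.natArrDst, Op.realArrDst, Op.apply,
      Memory.setNat, Memory.setReal, Memory.setNatArr, Memory.setRealArr]

/-- The sets of written places are computed from the program text, so that later preservation claims
can be settled by `decide`. -/
theorem Exec.frame {c : Program} {σ τ : Memory} {t : ℕ} (h : Exec I c σ τ t) : Frame c σ τ := by
  induction h with
  | op o σ => exact Frame.op o σ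
  | seq _ _ ih ih' =>
    exact (ih.mono fun f x h => List.mem_append_left _ h).trans
      (ih'.mono fun f x h => List.mem_append_right _ h)
  | condTrue _ _ ih => exact ih.mono fun f x h => List.mem_append_left _ h
  | condFalse _ _ ih => exact ih.mono fun f x h => List.mem_append_right _ h
  | loopEnd _ => exact Frame.refl _ _
  | loopStep _ _ _ ih ih' => exact Frame.trans (ih.mono fun f x h => h) ih'

namespace WP

variable {c d : Program} {Q Q' : Memory → Prop} {T U : ℕ} {σ : Memory}

theorem mono (h : WP I c Q T σ) (hT : T ≤ U) (hQ : ∀ τ, Frame c σ τ → Q τ → Q' τ) :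
    WP I c Q' U σ := by
  obtain ⟨τ, t, he, ht, hq⟩ := h
  exact ⟨τ, t, he, ht.trans hT, hQ τ he.frame hq⟩

theorem op {o : Op} (h : Q (o.apply I σ)) : WP I (.op o) Q 1 σ :=
  ⟨_, 1, .op o σ, le_rfl, h⟩

theorem skip (h : Q (σ.setNat 24 0)) : WP I .skip Q 1 σ := op h

theorem seq (h : WP I c (fun τ => WP I d Q U τ) T σ) : WP I (.seq c d) Q (T + U) σ := by
  obtain ⟨τ, t, he, ht, ρ, u, he', hu, hq⟩ := h
  exact ⟨ρ, t + u, .seq he he', add_le_add ht hu, hq⟩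

theorem pre {os : List Op} (h : WP I c Q T (os.foldl (fun σ o => o.apply I σ) σ)) :
    WP I (.pre os c) Q (os.length + T) σ := by
  induction os generalizing σ with
  | nil => simpa [Program.pre] using h
  | cons o os ih =>
    have := WP.seq (c := .op o) (d := .pre os c) (Q := Q) (T := 1) (op (ih h))
    exact this.mono (by simp; omega) fun _ _ h => h

theorem cond {b : Test} (hT : b.Holds σ → WP I c Q T σ) (hF : ¬ b.Holds σ → WP I d Q T σ) :
    WP I (.cond b c d) Q (T + 1) σ := by
  by_cases h : b.Holds σ
  · obtain ⟨τ, t, he, ht, hq⟩ := hT h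
    exact ⟨τ, t + 1, .condTrue h he, by omega, hq⟩
  · obtain ⟨τ, t, he, ht, hq⟩ := hF h
    exact ⟨τ, t + 1, .condFalse h he, by omega, hq⟩

theorem pre_le {os : List Op} (hT : os.length ≤ T)
    (h : WP I c Q (T - os.length) (os.foldl (fun σ o => o.apply I σ) σ)) :
    WP I (.pre os c) Q T σ :=
  (pre h).mono (by omega) fun _ _ h => h

theorem cond_le {b : Test} (h1 : 1 ≤ T) (hT : b.Holds σ → WP I c Q (T - 1) σ)
    (hF : ¬ b.Holds σ → WP I d Q (T - 1) σ) : WP I (.cond b c d) Q T σ :=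
  (cond hT hF).mono (by omega) fun _ _ h => h

theorem skip_le (hT : 1 ≤ T) (h : Q (σ.setNat 24 0)) : WP I .skip Q T σ :=
  (skip h).mono hT fun _ _ h => h

theorem loopEnd {b : Test} (h : ¬ b.Holds σ) (hQ : Q σ) : WP I (.loop b c) Q 1 σ :=
  ⟨σ, 1, .loopEnd h, le_rfl, hQ⟩

theorem loopStep {b : Test} (h : b.Holds σ) (hc : WP I c (WP I (.loop b c) Q U) T σ) :
    WP I (.loop b c) Q (T + U + 1) σ := by
  obtain ⟨τ, t, he, ht, ρ, u, he', hu, hq⟩ := hc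
  exact ⟨ρ, t + u + 1, .loopStep h he he', by omega, hq⟩

/-- A loop with a known number of rounds. -/
theorem loop_count {b : Test} (D : ℕ → Memory → Prop) (N : ℕ)
    (hb : ∀ i σ, D i σ → (b.Holds σ ↔ i < N))
    (hc : ∀ i < N, ∀ σ, D i σ → WP I c (D (i + 1)) T σ) (k : ℕ) (hk : k ≤ N)
    (hσ : D (N - k) σ) : WP I (.loop b c) (D N) (k * (T + 1) + 1) σ := by
  induction k generalizing σ with
  | zero => simpa using loopEnd (by rw [hb _ _ hσ]; simp) hσ
  | succ k ih =>
    refine (loopStep (T := T) (U := k * (T + 1) + 1) ?_ ?_).mono (by ring_nf; omega)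
      fun _ _ h => h
    · rw [hb _ _ hσ]; omega
    · refine (hc (N - (k + 1)) (by omega) σ hσ).mono le_rfl fun τ _ hτ => ih (by omega) ?_
      rwa [show N - (k + 1) + 1 = N - k by omega] at hτ

/-- Each round pays T for the body, one step for the increment and one for the test; the final 2
pays for the initialization and the failing test. The body may use the frame relative to σ, which
keeps constants out of the invariant D. -/
theorem forLoop {x y : ℕ} (D : ℕ → Memory → Prop) {N : ℕ} (hN : σ.nat y = N) (h5 : σ.nat 5 = 1)
    (hx : x ∉ c.collect Op.natDst) (hy : y ∉ c.collect Op.natDst) (hc5 : 5 ∉ c.collect Op.natDst)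
    (hxy : x ≠ y) (hx5 : x ≠ 5) (h0 : D 0 (σ.setNat x 0))
    (hc : ∀ i < N, ∀ τ, Frame (.forLoop x y c) σ τ → τ.nat x = i → D i τ →
      WP I c (fun ρ => D (i + 1) (ρ.setNat x (i + 1))) T τ) :
    WP I (.forLoop x y c) (D N) (N * (T + 2) + 2) σ := by
  have hsub : ∀ f z, z ∈ c.collect f → z ∈ (Program.forLoop x y c).collect f := fun f z h => by
    simp [Program.forLoop, Program.collect, h]
  have hmem : x ∈ (Program.forLoop x y c).collect Op.natDst := by
    simp [Program.forLoop, Program.collect, Op.natDst]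
  have hset : ∀ (ρ : Memory) k, Frame (.forLoop x y c) ρ (ρ.setNat x k) := fun ρ k =>
    ⟨fun z hz => Function.update_of_ne (fun h : z = x => hz (h ▸ hmem)) _ _, fun _ _ => rfl,
      fun _ _ => rfl, fun _ _ => rfl⟩
  have h := WP.seq (I := I) (c := .op (.natConst x 0))
    (d := .loop (.natLt x y) (.seq c (.op (.natAdd x x 5)))) (Q := D N) (T := 1)
    (U := N * (T + 1 + 1) + 1) (σ := σ) (op ?_)
  · exact h.mono (by rw [show T + 1 + 1 = T + 2 from rfl]; omega) fun _ _ h => h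
  refine (loop_count (T := T + 1)
    (fun i τ => D i τ ∧ τ.nat x = i ∧ τ.nat y = N ∧ τ.nat 5 = 1 ∧ Frame (.forLoop x y c) σ τ)
    N ?_ ?_ N le_rfl ?_).mono le_rfl fun _ _ h => h.1
  · rintro i τ ⟨-, hi, hy, -⟩
    simp [Test.Holds, hi, hy]
  · rintro i hi τ ⟨hD, hxi, hyN, h51, hF⟩
    refine seq ((hc i hi τ hF hxi hD).mono le_rfl fun ρ hFρ hρ => op ?_)
    have e1 : ρ.nat x = i := (hFρ.nat x hx).trans hxi
    have e2 : ρ.nat 5 = 1 := (hFρ.nat 5 hc5).trans h51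
    have e3 : ρ.nat y = N := (hFρ.nat y hy).trans hyN
    simp only [Op.apply, e1, e2]
    refine ⟨hρ, ?_, ?_, ?_, ?_⟩
    · simp [Memory.setNat]
    · simpa [Memory.setNat, Function.update_of_ne hxy.symm] using e3
    · simpa [Memory.setNat, Function.update_of_ne hx5.symm] using e2
    · exact (hF.trans (hFρ.mono hsub)).trans (hset _ _)
  · rw [Nat.sub_self]
    refine ⟨h0, ?_, ?_, ?_, hset _ _⟩
    · simp [Op.apply, Memory.setNat]
    · simpa [Op.apply, Memory.setNat, Function.update_of_ne hxy.symm] using hN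
    · simpa [Op.apply, Memory.setNat, Function.update_of_ne hx5.symm] using h5

end WP

open Program

/-! ### The program

Natural registers: `1` number of edges, `2` source, `3` target, `4` number of nodes, `5` one,
`6` zero, `7` number of budget levels, `8` largest label of former searches, `9` largest label,
`10` round, `11` budget level `j`, `12` `n * j`, `13` increase `k` of the level, `14` bound for `k`,
`15` `n * (j + k)`, `16` edge, `26` success of the last search.
Real registers: `3` error `ε₁` of one search, `4` one, `5` zero, `6` `1 + ε₁`, `10` tested bound,
`11` budget unit, `12` budget of the edge, `20` fuel consumption of all edges at full power.
Arrays: natural `1` label for a node and a level, natural `2` last label of a node, natural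
`3`, `4`, `5` predecessor, last edge and length of a label, real `1`, `2` charge and last parameter
of a label. -/

/-- Append a label for the path with predecessor `18`, edge `16`, parameter `15`, charge `18`. -/
def createLabel : Program :=
  pre [.natAdd 9 9 5, .natStore 1 19 9, .natStore 2 21 9, .natStore 3 9 18, .natStore 4 9 16,
    .natLoad 24 5 18, .natAdd 24 24 5, .natStore 5 9 24, .realStore 1 9 18, .realStore 2 9 15] skip

/-- Append a label if it improves on the present one. -/
def improveLabel : Program :=
  -- The value -1 stands for an empty cell: it is below every feasible charge, so any candidate
  -- beats it.
  pre [.edgeTgt 21 16, .natAdd 19 21 15, .natLoad 20 1 19, .realConst 19 (-1)]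
    (seq (cond (.natLt 8 20) (op (.realLoad 19 1 20)) skip)
      (cond (.realLt 19 18) createLabel skip))

/-- Drive edge `16` with budget `12`, starting with label `18`. -/
def driveEdge : Program :=
  pre [.realLoad 13 1 18, .invFuel 14 16 12, .realSub 16 13 2, .invBatt 15 16 16]
    -- Real register 5 is zero, so the addition is a copy.
    (seq (cond (.realLt 14 15) (op (.realAdd 15 14 5)) skip)
      (pre [.evalFuel 16 16 15, .evalBatt 17 16 15, .realSub 18 13 17]
        -- The fuel has to be tested again: if no parameter meets the budget, the inverse operation
        -- returns 0 all the same.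
        (cond (.realLt 12 16) skip (cond (.realLt 18 5) skip improveLabel))))

/-- Drive edge `16` with budget `12`, starting with a path of level `11`. -/
def relaxEdge : Program :=
  pre [.edgeSrc 17 16, .natAdd 17 17 12, .natLoad 18 1 17] (cond (.natLt 8 18) driveEdge skip)

/-! ### The table of labels and its invariant -/

/-- The table has a route to `v` with budget level `j` and charge at least `b`. -/
def Has (base : ℕ) (σ : Memory) (v : Fin n) (j : ℕ) (b : ℝ) : Prop :=
  base < σ.natArr 1 (v + n * j) ∧ b ≤ σ.realArr 1 (σ.natArr 1 (v + n * j))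

/-- Every entry of the table `τ` is at least as good as that of `σ`. -/
def Ext (n base : ℕ) (σ τ : Memory) : Prop :=
  ∀ (v : Fin n) j b, Has base σ v j b → Has base τ v j b

theorem Ext.refl (n base : ℕ) (σ : Memory) : Ext n base σ σ := fun _ _ _ h => h

theorem Ext.trans {base : ℕ} {σ τ ρ : Memory} (h : Ext n base σ τ) (h' : Ext n base τ ρ) :
    Ext n base σ ρ := fun v j b hb => h' v j b (h v j b hb)

/-- The labels above `base` stand for the routes `R`. -/
structure TableInv (I : Instance n m) (δ : ℝ) (J base : ℕ) (σ : Memory) (R : ℕ → Route m) :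
    Prop where
  best_le : ∀ i, σ.natArr 1 i ≤ σ.nat 9
  last_le : ∀ i, σ.natArr 2 i ≤ σ.nat 9
  len : ∀ x, base < x → x ≤ σ.nat 9 → σ.natArr 5 x = (R x).length
  chain : ∀ x, base < x → x ≤ σ.nat 9 → R x = [] ∨
    (base < σ.natArr 3 x ∧ σ.natArr 3 x < x) ∧ ∃ p : Fin m × ℝ,
      R x = R (σ.natArr 3 x) ++ [p] ∧ σ.natArr 4 x = p.1 ∧ σ.realArr 2 x = p.2
  charge : ∀ x, base < x → x ≤ σ.nat 9 → σ.realArr 1 x = I.B₀ - I.totalBatt (R x)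
  ok : ∀ x, base < x → x ≤ σ.nat 9 → I.ChargeOK I.B₀ (R x)
  best : ∀ (v : Fin n) j, j < J → base < σ.natArr 1 (v + n * j) →
    I.IsPath I.s v (R (σ.natArr 1 (v + n * j))) ∧
      I.totalFuel (R (σ.natArr 1 (v + n * j))) ≤ j * δ
  last : ∀ v : Fin n, base < σ.natArr 2 v →
    I.IsPath I.s v (R (σ.natArr 2 v)) ∧ I.totalFuel (R (σ.natArr 2 v)) ≤ (J - 1) * δ
  -- Because of this field, a single look at the target's last label shows that all its levels are
  -- empty.
  best_last : ∀ (v : Fin n) j, j < J → base < σ.natArr 1 (v + n * j) → base < σ.natArr 2 v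

/-- Different pairs of node and level occupy different cells of the table. -/
theorem add_mul_inj {v w : Fin n} {i j : ℕ} (h : (v : ℕ) + n * i = w + n * j) :
    v = w ∧ i = j := by
  have hn : 0 < n := v.pos
  have h1 := congrArg (· % n) h
  have h2 := congrArg (· / n) h
  simp only [Nat.add_mul_mod_self_left, Nat.mod_eq_of_lt v.2, Nat.mod_eq_of_lt w.2] at h1
  simp only [Nat.add_mul_div_left _ _ hn, Nat.div_eq_of_lt v.2, Nat.div_eq_of_lt w.2] at h2
  exact ⟨Fin.ext h1, by omega⟩

/-- What `createLabel` does to the arrays. -/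
structure Created (n : ℕ) (σ τ : Memory) (e : ℕ) (v i l : ℕ) (x b : ℝ) : Prop where
  cnt : τ.nat 9 = σ.nat 9 + 1
  best : τ.natArr 1 = Function.update (σ.natArr 1) i (σ.nat 9 + 1)
  last : τ.natArr 2 = Function.update (σ.natArr 2) v (σ.nat 9 + 1)
  pred : τ.natArr 3 = Function.update (σ.natArr 3) (σ.nat 9 + 1) l
  edge : τ.natArr 4 = Function.update (σ.natArr 4) (σ.nat 9 + 1) e
  len : τ.natArr 5 = Function.update (σ.natArr 5) (σ.nat 9 + 1) (σ.natArr 5 l + 1)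
  charge : τ.realArr 1 = Function.update (σ.realArr 1) (σ.nat 9 + 1) b
  param : τ.realArr 2 = Function.update (σ.realArr 2) (σ.nat 9 + 1) x

/-- The number of the new label is unused, so no stored charge is lost; the one redirected cell was
empty or held no larger charge. -/
theorem TableInv.ext_of_created {δ : ℝ} {J base : ℕ} {σ τ : Memory} {R : ℕ → Route m}
    (h : TableInv I δ J base σ R) {e v i l : ℕ} {x b : ℝ} (hC : Created n σ τ e v i l x b)
    (hbase : base ≤ σ.nat 9)
    (hb : base < σ.natArr 1 i → σ.realArr 1 (σ.natArr 1 i) ≤ b) : Ext n base σ τ := by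
  rintro w j c ⟨h1, h2⟩
  rw [Has, hC.best, hC.charge]
  by_cases hi : (w : ℕ) + n * j = i
  · subst hi
    simp only [Function.update_self]
    exact ⟨by omega, h2.trans (hb h1)⟩
  · have := h.best_le ((w : ℕ) + n * j)
    rw [Function.update_of_ne hi, Function.update_of_ne (by omega)]
    exact ⟨h1, h2⟩

/-- Labels are only appended, never changed, so predecessor chains stay valid even when the cell
that pointed to a predecessor is redirected. The levels j and k add up as the fuel bounds do. -/
theorem TableInv.created {δ : ℝ} {J base : ℕ} {σ τ : Memory} {R : ℕ → Route m}
    (h : TableInv I δ J base σ R) {e : Fin m} {j k l : ℕ} {x : ℝ} (hδ : 0 ≤ δ)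
    (hC : Created n σ τ e (I.tgt e) (I.tgt e + n * (j + k)) l x (σ.realArr 1 l - I.batt e x))
    (hl : l = σ.natArr 1 (I.src e + n * j)) (hlb : base < l) (hjk : j + k < J)
    (hx : x ∈ Set.Icc (0 : ℝ) 1) (hf : I.fuel e x ≤ k * δ)
    (hc : σ.realArr 1 l - I.batt e x ∈ Set.Icc 0 I.cap) :
    TableInv I δ J base τ (Function.update R (σ.nat 9 + 1) (R l ++ [(e, x)])) := by
  have hle : l ≤ σ.nat 9 := hl ▸ h.best_le _
  have hR : ∀ y, y ≤ σ.nat 9 →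
      Function.update R (σ.nat 9 + 1) (R l ++ [(e, x)]) y = R y :=
    fun y hy => Function.update_of_ne (by omega) _ _
  obtain ⟨hp, hfl⟩ := hl ▸ h.best (I.src e) j (by omega) (hl ▸ hlb)
  have hnew : I.IsPath I.s (I.tgt e) (R l ++ [(e, x)]) :=
    Instance.isPath_append.2 ⟨_, hp, rfl, hx, rfl⟩
  have hfnew : I.totalFuel (R l ++ [(e, x)]) ≤ (j + k) * δ := by
    rw [Instance.totalFuel_append]; simp; linarith
  have hJ : ((j : ℝ) + k) ≤ J - 1 := by
    have : ((j + k + 1 : ℕ) : ℝ) ≤ J := by exact_mod_cast hjk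
    push_cast at this; linarith
  constructor
  · intro i
    rw [hC.best, hC.cnt, Function.update_apply]
    split_ifs
    · exact le_rfl
    · exact (h.best_le i).trans (Nat.le_succ _)
  · intro i
    rw [hC.last, hC.cnt, Function.update_apply]
    split_ifs
    · exact le_rfl
    · exact (h.last_le i).trans (Nat.le_succ _)
  · intro y hy hy'
    rw [hC.cnt] at hy'
    rw [hC.len]
    rcases Nat.le_succ_iff.1 hy' with hy' | rfl
    · rw [hR _ hy', Function.update_of_ne (by omega), h.len y hy hy']
    · simp [h.len l hlb hle]
  · intro y hy hy'
    rw [hC.cnt] at hy'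
    rw [hC.pred, hC.edge, hC.param]
    rcases Nat.le_succ_iff.1 hy' with hy' | rfl
    · have hne : y ≠ σ.nat 9 + 1 := by omega
      rw [hR _ hy', Function.update_of_ne hne, Function.update_of_ne hne, Function.update_of_ne hne]
      rcases h.chain y hy hy' with h0 | ⟨h0, p, hp⟩
      · exact Or.inl h0
      · exact Or.inr ⟨h0, p, by rwa [hR _ (h0.2.le.trans hy')]⟩
    · simp only [Nat.succ_eq_add_one, Function.update_self]
      exact Or.inr ⟨⟨hlb, by omega⟩, (e, x), by rw [hR _ hle], rfl, rfl⟩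
  · intro y hy hy'
    rw [hC.cnt] at hy'
    rw [hC.charge]
    rcases Nat.le_succ_iff.1 hy' with hy' | rfl
    · rw [hR _ hy', Function.update_of_ne (by omega), h.charge y hy hy']
    · simp only [Nat.succ_eq_add_one, Function.update_self]
      rw [h.charge l hlb hle, Instance.totalBatt_append]; simp; ring
  · intro y hy hy'
    rw [hC.cnt] at hy'
    rcases Nat.le_succ_iff.1 hy' with hy' | rfl
    · rw [hR _ hy']; exact h.ok y hy hy'
    · simp only [Nat.succ_eq_add_one, Function.update_self]
      refine Instance.chargeOK_append.2 ⟨h.ok l hlb hle, ?_, trivial⟩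
      rwa [← h.charge l hlb hle]
  · intro v i hi hv
    rw [hC.best] at hv ⊢
    by_cases hvi : (v : ℕ) + n * i = I.tgt e + n * (j + k)
    · obtain ⟨rfl, rfl⟩ := add_mul_inj hvi
      simp only [Function.update_self]
      exact ⟨hnew, by push_cast; exact hfnew⟩
    · rw [Function.update_of_ne hvi] at hv ⊢
      rw [hR _ (h.best_le _)]
      exact h.best v i hi hv
  · intro v hv
    rw [hC.last] at hv ⊢
    by_cases hve : (v : ℕ) = I.tgt e
    · obtain rfl := Fin.ext hve
      simp only [Function.update_self]
      exact ⟨hnew, hfnew.trans (mul_le_mul_of_nonneg_right hJ hδ)⟩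
    · rw [Function.update_of_ne hve] at hv ⊢
      rw [hR _ (h.last_le _)]
      exact h.last v hv
  · intro v i hi hv
    rw [hC.best] at hv
    rw [hC.last]
    by_cases hvi : (v : ℕ) + n * i = I.tgt e + n * (j + k)
    · obtain ⟨rfl, rfl⟩ := add_mul_inj hvi
      simp only [Function.update_self]
      omega
    · rw [Function.update_of_ne hvi] at hv
      have := h.best_last v i hi hv
      rw [Function.update_apply]
      split_ifs
      · omega
      · exact this

/-- Label numbers decrease along predecessors. So a route is no longer than the number of labels
created, which bounds the time for writing it out. -/
theorem TableInv.length_lt {δ : ℝ} {J base : ℕ} {σ : Memory} {R : ℕ → Route m}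
    (h : TableInv I δ J base σ R) {x : ℕ} (hx : base < x) (hx' : x ≤ σ.nat 9) :
    base + (R x).length < x := by
  induction x using Nat.strong_induction_on with
  | _ x ih =>
    rcases h.chain x hx hx' with h0 | ⟨⟨h0, h3⟩, p, hp, -⟩
    · simpa [h0] using hx
    · have := ih _ h3 h0 (h3.le.trans hx')
      rw [hp, List.length_append, List.length_singleton]
      omega

theorem atEdge_val {β : Type} (e : Fin m) (z : β) (f : Fin m → β) : atEdge (e : ℕ) z f = f e := by
  simp [atEdge]

theorem wp_createLabel {σ : Memory} (h5 : σ.nat 5 = 1) {Q : Memory → Prop}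
    (hQ : ∀ τ, Created n σ τ (σ.nat 16) (σ.nat 21) (σ.nat 19) (σ.nat 18) (σ.real 15)
      (σ.real 18) → Q τ) : WP I createLabel Q 11 σ := by
  refine WP.pre_le (by decide) (WP.skip_le (by decide) (hQ _ ?_))
  constructor <;>
    simp [Op.apply, Memory.setNat, Memory.setReal, Memory.setNatArr, Memory.setRealArr, h5]

theorem TableInv.congr {δ : ℝ} {J base : ℕ} {σ τ : Memory} {R : ℕ → Route m}
    (h : TableInv I δ J base σ R) (h9 : τ.nat 9 = σ.nat 9) (hn : τ.natArr = σ.natArr)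
    (hr : τ.realArr = σ.realArr) : TableInv I δ J base τ R := by
  obtain ⟨a1, a2, a3, a4, a5, a6, a7, a8, a9⟩ := h
  constructor <;> simpa only [hn, hr, h9]

theorem Has.congr {base : ℕ} {σ τ : Memory} {v : Fin n} {j : ℕ} {b : ℝ} (h : Has base σ v j b)
    (hn : τ.natArr = σ.natArr) (hr : τ.realArr = σ.realArr) : Has base τ v j b := by
  unfold Has
  rw [hn, hr]; exact h

theorem wp_improveLabel {δ : ℝ} {J base : ℕ} {σ : Memory} {R : ℕ → Route m}
    (h : TableInv I δ J base σ R) {e : Fin m} {j k : ℕ} (hδ : 0 ≤ δ) (hjk : j + k < J)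
    (h5 : σ.nat 5 = 1) (h8 : σ.nat 8 = base) (h15 : σ.nat 15 = n * (j + k)) (h16 : σ.nat 16 = e)
    (h18 : σ.nat 18 = σ.natArr 1 (I.src e + n * j)) (hb : base < σ.nat 18)
    (hx : σ.real 15 ∈ Set.Icc (0 : ℝ) 1) (hf : I.fuel e (σ.real 15) ≤ k * δ)
    (hc : σ.real 18 = σ.realArr 1 (σ.nat 18) - I.batt e (σ.real 15))
    (hcap : σ.real 18 ∈ Set.Icc 0 I.cap) :
    WP I improveLabel (fun τ => (∃ R, TableInv I δ J base τ R) ∧ Ext n base σ τ ∧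
      Has base τ (I.tgt e) (j + k) (σ.real 18)) 20 σ := by
  have hle : base ≤ σ.nat 9 := hb.le.trans (h18 ▸ h.best_le _)
  refine WP.pre_le (by decide) ?_
  simp only [List.foldl, Op.apply, h16, atEdge_val]
  refine (WP.seq (T := 2) (U := 12) (Q := _) ?_).mono (by decide) fun _ _ h => h
  -- Both ways of setting register 19, to the present charge or to -1, continue with this common
  -- part.
  have main : ∀ τ : Memory, τ.natArr = σ.natArr → τ.realArr = σ.realArr → τ.nat 9 = σ.nat 9 →
      τ.nat 5 = 1 → τ.nat 16 = e → τ.nat 21 = I.tgt e → τ.nat 19 = I.tgt e + n * (j + k) →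
      τ.nat 18 = σ.nat 18 → τ.real 15 = σ.real 15 → τ.real 18 = σ.real 18 →
      (base < σ.natArr 1 (I.tgt e + n * (j + k)) →
        τ.real 19 = σ.realArr 1 (σ.natArr 1 (I.tgt e + n * (j + k)))) →
      (¬ base < σ.natArr 1 (I.tgt e + n * (j + k)) → τ.real 19 = -1) →
      WP I (.cond (.realLt 19 18) createLabel .skip)
        (fun τ => (∃ R, TableInv I δ J base τ R) ∧ Ext n base σ τ ∧
          Has base τ (I.tgt e) (j + k) (σ.real 18)) 12 τ := by
    intro τ en er t9 t5 t16 t21 t19 t18 r15 r18 hv hnv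
    refine WP.cond_le (by decide) (fun hlt => ?_) fun hlt => WP.skip_le (by decide) ?_
    · simp only [Test.Holds] at hlt
      refine wp_createLabel t5 fun ρ hρ => ?_
      rw [t16, t21, t19, t18, r15, r18] at hρ
      have hρ' : Created n σ ρ e (I.tgt e) (I.tgt e + n * (j + k)) (σ.nat 18) (σ.real 15)
          (σ.real 18) := by
        obtain ⟨a1, a2, a3, a4, a5, a6, a7, a8⟩ := hρ
        rw [en] at a2 a3 a4 a5 a6
        rw [er] at a7 a8
        rw [t9] at a1 a2 a3 a4 a5 a6 a7 a8
        exact ⟨a1, a2, a3, a4, a5, a6, a7, a8⟩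
      refine ⟨⟨_, h.created hδ (hc ▸ hρ') h18 hb hjk hx hf (hc ▸ hcap)⟩,
        h.ext_of_created hρ' hle fun hb' => ?_, ?_⟩
      · rw [← hv hb', ← r18]; exact hlt.le
      · simp only [Has, hρ'.best, hρ'.charge, Function.update_self]
        exact ⟨by omega, le_rfl⟩
    · simp only [Test.Holds, not_lt] at hlt
      -- The candidate charge is nonnegative, so it can fail only against an occupied cell.
      have hb' : base < σ.natArr 1 (I.tgt e + n * (j + k)) := by
        by_contra hb'
        rw [hnv hb', r18] at hlt
        linarith [hcap.1]
      refine ⟨⟨R, h.congr (by simpa [Memory.setNat] using t9) en er⟩, ?_, ?_⟩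
      · rintro v i b ⟨hb1, hb2⟩
        exact ⟨by simpa [Memory.setNat, en] using hb1, by simpa [Memory.setNat, en, er] using hb2⟩
      · refine ⟨by simpa [Memory.setNat, en] using hb', ?_⟩
        simp only [Memory.setNat, en, er]
        rw [← hv hb', ← r18]; exact hlt
  refine WP.cond_le (by decide) (fun hlt => (WP.op ?_).mono (by decide) fun _ _ h => h)
    fun hlt => WP.skip_le (by decide) ?_
  · simp [Test.Holds, Memory.setNat, Memory.setReal, h8, h15] at hlt
    apply main <;> simp [Op.apply, Memory.setNat, Memory.setReal, h15, h16, h5]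
    omega
  · simp [Test.Holds, Memory.setNat, Memory.setReal, h8, h15] at hlt
    apply main <;> simp [Memory.setNat, Memory.setReal, h15, h16, h5]
    omega

theorem wp_driveEdge (hI : I.Admissible) (h1 : I.CyclePreventionI) {δ : ℝ} {J base : ℕ}
    {σ : Memory} {R : ℕ → Route m} (h : TableInv I δ J base σ R) {e : Fin m} {j k : ℕ}
    (hδ : 0 ≤ δ) (hjk : j + k < J) (h5 : σ.nat 5 = 1) (h8 : σ.nat 8 = base)
    (h15 : σ.nat 15 = n * (j + k)) (h16 : σ.nat 16 = e)
    (h18 : σ.nat 18 = σ.natArr 1 (I.src e + n * j)) (hb : base < σ.nat 18)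
    (r2 : σ.real 2 = I.cap) (r5 : σ.real 5 = 0) (r12 : σ.real 12 = k * δ) :
    WP I driveEdge (fun τ => (∃ R, TableInv I δ J base τ R) ∧ Ext n base σ τ ∧
      ∀ b a, Has base σ (I.src e) j b → a ∈ Set.Icc (0 : ℝ) 1 → I.fuel e a ≤ k * δ →
        b - I.batt e a ∈ Set.Icc 0 I.cap → Has base τ (I.tgt e) (j + k) (b - I.batt e a)) 32 σ := by
  set b₀ := σ.realArr 1 (σ.nat 18) with hb₀
  have hle : σ.nat 18 ≤ σ.nat 9 := h18 ▸ h.best_le _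
  have hb₀c : b₀ ∈ Set.Icc 0 I.cap := by
    rw [hb₀, h.charge _ hb hle]
    exact (h.ok _ hb hle).final_mem hI.charge_mem
  set x := I.driveParam b₀ e (k * δ) with hx
  have hxm := hI.driveParam_mem h1 hb₀c.2 e (k * δ)
  have hopt : ∀ b a, Has base σ (I.src e) j b → a ∈ Set.Icc (0 : ℝ) 1 → I.fuel e a ≤ k * δ →
      b - I.batt e a ∈ Set.Icc 0 I.cap → I.fuel e x ≤ k * δ ∧
        b - I.batt e a ≤ b₀ - I.batt e x := by
    intro b a hbh ha hf hbc
    refine hI.driveParam_optimal h1 hb₀c.2 ?_ ha hf hbc.2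
    have := hbh.2
    rwa [← h18] at this
  refine WP.pre_le (by decide) ?_
  simp only [List.foldl, Op.apply, List.length]
  refine (WP.seq (T := 2) (U := 26) (Q := _) ?_).mono (by decide) fun _ _ h => h
  have main : ∀ τ : Memory, τ.natArr = σ.natArr → τ.realArr = σ.realArr →
      (∀ x, x ≠ 24 → τ.nat x = σ.nat x) →
      τ.real 2 = I.cap → τ.real 5 = 0 → τ.real 12 = k * δ → τ.real 13 = b₀ → τ.real 15 = x →
      WP I (pre [.evalFuel 16 16 15, .evalBatt 17 16 15, .realSub 18 13 17]
        (.cond (.realLt 12 16) .skip (.cond (.realLt 18 5) .skip improveLabel)))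
        (fun τ => (∃ R, TableInv I δ J base τ R) ∧ Ext n base σ τ ∧
      ∀ b a, Has base σ (I.src e) j b → a ∈ Set.Icc (0 : ℝ) 1 → I.fuel e a ≤ k * δ →
        b - I.batt e a ∈ Set.Icc 0 I.cap → Has base τ (I.tgt e) (j + k) (b - I.batt e a)) 26 τ := by
    intro τ en er enn t2 t5 t12 t13 t15
    refine WP.pre_le (by decide) ?_
    -- If the best parameter violates the budget or empties the battery, then by `hopt` no parameter
    -- is admissible from any charge the cell provides, and nothing has to be stored.
    have fail : ∀ ρ : Memory, ρ.natArr = σ.natArr → ρ.realArr = σ.realArr → ρ.nat 9 = σ.nat 9 →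
        ¬ (I.fuel e x ≤ k * δ ∧ 0 ≤ b₀ - I.batt e x) →
        (∃ R, TableInv I δ J base ρ R) ∧ Ext n base σ ρ ∧
        ∀ b a, Has base σ (I.src e) j b → a ∈ Set.Icc (0 : ℝ) 1 → I.fuel e a ≤ k * δ →
        b - I.batt e a ∈ Set.Icc 0 I.cap → Has base ρ (I.tgt e) (j + k) (b - I.batt e a) := by
      intro ρ hn hr h9 hno
      refine ⟨⟨R, h.congr h9 hn hr⟩, fun v i b hb => hb.congr hn hr, ?_⟩
      intro b a hbh ha hf hbc
      have := hopt b a hbh ha hf hbc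
      exact absurd ⟨this.1, hbc.1.trans this.2⟩ hno
    refine WP.cond_le (by decide) (fun hlt => WP.skip_le (by decide) ?_) fun hlt =>
      WP.cond_le (by decide) (fun hlt' => WP.skip_le (by decide) ?_) fun hlt' => ?_
    · simp [Test.Holds, Op.apply, Memory.setReal, enn, h16, t12, t15, atEdge_val] at hlt
      refine fail _ en er (by simp [Op.apply, Memory.setNat, Memory.setReal, enn]) ?_
      intro hc; linarith [hc.1]
    · simp [Test.Holds, Op.apply, Memory.setReal, enn, h16, t5, t13, t15, atEdge_val] at hlt'
      refine fail _ en er (by simp [Op.apply, Memory.setNat, Memory.setReal, enn]) ?_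
      intro hc; linarith [hc.2]
    · simp [Test.Holds, Op.apply, Memory.setReal, enn, h16, t12, t15, atEdge_val] at hlt
      simp [Test.Holds, Op.apply, Memory.setReal, enn, h16, t5, t13, t15, atEdge_val] at hlt'
      simp only [List.foldl, Op.apply]
      refine WP.mono (T := 20) (Q := ?Q) ?h (by decide) ?post
      case h =>
        refine wp_improveLabel (R := R) (δ := δ) (J := J) (base := base) (e := e) (j := j) (k := k)
          (h.congr ?_ ?_ ?_) hδ hjk ?_ ?_ ?_ ?_ ?_ ?_ ?_ ?_ ?_ ?_
        all_goals try simp [Memory.setReal, enn, en, er, h16, t13, t15, atEdge_val, h5, h8,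
          h15, h18]
        · rwa [← h18]
        · exact hxm
        · exact hlt
        · rw [hb₀, h18]
        · have := hI.driveParam_le_cap h1 hb₀c.2 e (k * δ)
          exact ⟨hlt', by linarith⟩
      · rintro ρ - ⟨⟨R', hR'⟩, hE, hH⟩
        refine ⟨⟨R', hR'⟩, fun v i b hb => hE v i b (hb.congr en er), ?_⟩
        intro b a hbh ha hf hbc
        have h3 := hH.2
        simp [Memory.setReal, enn, h16, t13, t15, atEdge_val] at h3
        exact ⟨hH.1, by linarith [(hopt b a hbh ha hf hbc).2]⟩
  refine WP.cond_le (by decide) (fun hlt => (WP.op ?_).mono (by decide) fun _ _ h => h)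
    fun hlt => WP.skip_le (by decide) ?_
  · simp [Test.Holds, Memory.setReal, h16, r2, r12, atEdge_val, -Set.mem_Icc,
      -tsub_le_iff_right] at hlt
    apply main <;> simp [-Set.mem_Icc, -tsub_le_iff_right, Op.apply, Memory.setReal, h16, r2,
      r5, r12, atEdge_val, hb₀]
    rw [hx, Instance.driveParam, min_eq_left hlt.le]
  · simp [Test.Holds, Memory.setReal, h16, r2, r12, atEdge_val, -Set.mem_Icc,
      -tsub_le_iff_right] at hlt
    apply main <;> simp +contextual [-Set.mem_Icc, -tsub_le_iff_right, Memory.setNat,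
      Memory.setReal, h16, r2, r5, r12, atEdge_val, hb₀]
    rw [hx, Instance.driveParam, min_eq_right hlt]

theorem wp_relaxEdge (hI : I.Admissible) (h1 : I.CyclePreventionI) {δ : ℝ} {J base : ℕ}
    {σ : Memory} {R : ℕ → Route m} (h : TableInv I δ J base σ R) {e : Fin m} {j k : ℕ}
    (hδ : 0 ≤ δ) (hjk : j + k < J) (h5 : σ.nat 5 = 1) (h8 : σ.nat 8 = base)
    (h12 : σ.nat 12 = n * j) (h15 : σ.nat 15 = n * (j + k)) (h16 : σ.nat 16 = e)
    (r2 : σ.real 2 = I.cap) (r5 : σ.real 5 = 0) (r12 : σ.real 12 = k * δ) :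
    WP I relaxEdge (fun τ => (∃ R, TableInv I δ J base τ R) ∧ Ext n base σ τ ∧
      ∀ b a, Has base σ (I.src e) j b → a ∈ Set.Icc (0 : ℝ) 1 → I.fuel e a ≤ k * δ →
        b - I.batt e a ∈ Set.Icc 0 I.cap → Has base τ (I.tgt e) (j + k) (b - I.batt e a)) 36 σ := by
  refine WP.pre_le (by decide) ?_
  simp only [List.foldl, Op.apply, h16, atEdge_val]
  refine WP.cond_le (by decide) (fun hlt => ?_) fun hlt => WP.skip_le (by decide) ?_
  · simp [Test.Holds, Memory.setNat, h8, h12] at hlt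
    refine WP.mono (T := 32) (Q := ?Q) ?h (by decide) ?post
    case h =>
      refine wp_driveEdge (R := R) (δ := δ) (J := J) (base := base) (e := e) (j := j) (k := k)
        hI h1 (h.congr ?_ ?_ ?_) hδ hjk ?_ ?_ ?_ ?_ ?_ ?_ ?_ ?_ ?_
      all_goals try simp [Memory.setNat, h5, h8, h12, h15, h16, r2, r5, r12]
      exact hlt
    · intro τ _ hτ
      exact ⟨hτ.1, fun v i b hb => hτ.2.1 v i b hb, fun b a hb ha hf hc => hτ.2.2 b a hb ha hf hc⟩
  · simp [Test.Holds, Memory.setNat, h8, h12] at hlt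
    refine ⟨⟨R, h.congr ?_ rfl rfl⟩, fun v i b hb => hb, fun b a hb => ?_⟩
    · simp [Memory.setNat]
    · exact absurd hb.1 (not_lt.2 hlt)

/-! ### The dynamic program over rounds, levels, budgets and edges -/

/-- Drive all edges with budget `12`. -/
def edgeLoop : Program := forLoop 16 1 relaxEdge

/-- Drive all edges with all budgets, starting with a path of level `11`. -/
def budgetLoop : Program :=
  forLoop 13 14 (seq edgeLoop (pre [.natAdd 15 15 4, .realAdd 12 12 11] skip))

/-- Drive all edges with all budgets, starting with all paths known. -/
def levelLoop : Program :=
  forLoop 11 7 (pre [.natAdd 15 12 6, .realConst 12 0, .natSub 14 7 11]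
    (seq budgetLoop (op (.natAdd 12 12 4))))

/-- Extend all paths as often as there are nodes. -/
def roundLoop : Program := forLoop 10 4 (seq (op (.natConst 12 0)) levelLoop)

/-- The registers that are constant during a search. -/
structure SearchRegs (I : Instance n m) (δ : ℝ) (J base : ℕ) (σ : Memory) : Prop where
  n1 : σ.nat 1 = m
  n4 : σ.nat 4 = n
  n5 : σ.nat 5 = 1
  n6 : σ.nat 6 = 0
  n7 : σ.nat 7 = J
  n8 : σ.nat 8 = base
  r2 : σ.real 2 = I.cap
  r5 : σ.real 5 = 0
  r11 : σ.real 11 = δ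

theorem SearchRegs.frame {δ : ℝ} {J base : ℕ} {σ τ : Memory} {c : Program}
    (h : SearchRegs I δ J base σ) (hF : Frame c σ τ)
    (hn : ∀ x ∈ [1, 4, 5, 6, 7, 8], x ∉ c.collect Op.natDst)
    (hr : ∀ x ∈ [2, 5, 11], x ∉ c.collect Op.realDst) : SearchRegs I δ J base τ := by
  obtain ⟨a1, a2, a3, a4, a5, a6, a7, a8, a9⟩ := h
  constructor
  · rwa [hF.nat _ (hn _ (by simp))]
  · rwa [hF.nat _ (hn _ (by simp))]
  · rwa [hF.nat _ (hn _ (by simp))]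
  · rwa [hF.nat _ (hn _ (by simp))]
  · rwa [hF.nat _ (hn _ (by simp))]
  · rwa [hF.nat _ (hn _ (by simp))]
  · rwa [hF.real _ (hr _ (by simp))]
  · rwa [hF.real _ (hr _ (by simp))]
  · rwa [hF.real _ (hr _ (by simp))]

/-- All routes of level `j` in `σ`, extended by the edge `e` with budget `k`, are in `τ`. -/
def Done (I : Instance n m) (δ : ℝ) (base : ℕ) (σ : Memory) (j k : ℕ) (e : Fin m)
    (τ : Memory) : Prop :=
  ∀ b a, Has base σ (I.src e) j b → a ∈ Set.Icc (0 : ℝ) 1 → I.fuel e a ≤ k * δ →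
    b - I.batt e a ∈ Set.Icc 0 I.cap → Has base τ (I.tgt e) (j + k) (b - I.batt e a)

/-- Table entries only improve. So what was achieved for the entries present at the start of a loop
survives, although the table changes while the loop runs. -/
theorem Done.mono {δ : ℝ} {base : ℕ} {σ σ' τ τ' : Memory} {j k : ℕ} {e : Fin m}
    (h : Done I δ base σ j k e τ) (hσ : Ext n base σ' σ) (hτ : Ext n base τ τ') :
    Done I δ base σ' j k e τ' :=
  fun b a hb ha hf hc => hτ _ _ _ (h b a (hσ _ _ _ hb) ha hf hc)

theorem wp_edgeLoop (hI : I.Admissible) (h1 : I.CyclePreventionI) {δ : ℝ} (hδ : 0 ≤ δ)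
    {J base : ℕ} {σ : Memory} (h : ∃ R, TableInv I δ J base σ R) (hs : SearchRegs I δ J base σ)
    {j k : ℕ} (hjk : j + k < J) (h12 : σ.nat 12 = n * j) (h15 : σ.nat 15 = n * (j + k))
    (r12 : σ.real 12 = k * δ) :
    WP I edgeLoop (fun τ => (∃ R, TableInv I δ J base τ R) ∧ Ext n base σ τ ∧
      ∀ e, Done I δ base σ j k e τ) (m * 38 + 2) σ := by
  refine (WP.forLoop (T := 36) (fun i τ => (∃ R, TableInv I δ J base τ R) ∧ Ext n base σ τ ∧
      ∀ e : Fin m, e < i → Done I δ base σ j k e τ) hs.n1 hs.n5 (by decide) (by decide)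
      (by decide) (by decide) (by decide) ?_ ?_).mono le_rfl ?_
  · obtain ⟨R, hR⟩ := h
    exact ⟨⟨R, hR.congr (by simp [Memory.setNat]) rfl rfl⟩, Ext.refl _ _ _,
      fun e he => absurd he (Nat.not_lt_zero _)⟩
  · rintro i hi τ hF hτi ⟨⟨R, hR⟩, hE, hD⟩
    have hs' := hs.frame hF (by decide) (by decide)
    have e12 := (hF.nat 12 (by decide)).trans h12
    have e15 := (hF.nat 15 (by decide)).trans h15
    have er12 := (hF.real 12 (by decide)).trans r12
    refine (wp_relaxEdge (e := ⟨i, hi⟩) hI h1 hR hδ hjk hs'.n5 hs'.n8 e12 e15 hτi hs'.r2 hs'.r5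
      er12).mono le_rfl ?_
    rintro ρ - ⟨⟨R', hR'⟩, hE', hD'⟩
    refine ⟨⟨R', hR'.congr (by simp [Memory.setNat]) rfl rfl⟩, hE.trans hE', fun e he => ?_⟩
    rcases Nat.lt_succ_iff_lt_or_eq.1 he with he | he
    · exact (hD e he).mono (Ext.refl _ _ _) hE'
    · obtain rfl : e = ⟨i, hi⟩ := Fin.ext he
      exact Done.mono (I := I) hD' hE (Ext.refl _ _ _)
  · rintro τ - ⟨hR, hE, hD⟩
    exact ⟨hR, hE, fun e => hD e e.2⟩

theorem wp_budgetLoop (hI : I.Admissible) (h1 : I.CyclePreventionI) {δ : ℝ} (hδ : 0 ≤ δ)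
    {J base : ℕ} {σ : Memory} (h : ∃ R, TableInv I δ J base σ R) (hs : SearchRegs I δ J base σ)
    {j : ℕ} (h12 : σ.nat 12 = n * j) (h14 : σ.nat 14 = J - j) (h15 : σ.nat 15 = n * j)
    (r12 : σ.real 12 = 0) :
    WP I budgetLoop (fun τ => (∃ R, TableInv I δ J base τ R) ∧ Ext n base σ τ ∧
      ∀ k < J - j, ∀ e, Done I δ base σ j k e τ) (J * (m * 38 + 7) + 2) σ := by
  refine (WP.forLoop (T := m * 38 + 2 + 3) (fun k τ => (∃ R, TableInv I δ J base τ R) ∧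
      Ext n base σ τ ∧ (∀ k' < k, ∀ e, Done I δ base σ j k' e τ) ∧
      τ.nat 15 = n * (j + k) ∧ τ.real 12 = k * δ) h14 hs.n5 (by decide) (by decide)
      (by decide) (by decide) (by decide) ?_ ?_).mono
      (by gcongr; exact Nat.sub_le _ _) ?_
  · obtain ⟨R, hR⟩ := h
    refine ⟨⟨R, hR.congr (by simp [Memory.setNat]) rfl rfl⟩, Ext.refl _ _ _,
      fun e he => absurd he (Nat.not_lt_zero _), ?_, ?_⟩
    · simpa [Memory.setNat] using h15
    · simpa [Memory.setNat] using r12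
  · rintro k hk τ hF hτk ⟨hR, hE, hD, e15, er12⟩
    have hs' := hs.frame hF (by decide) (by decide)
    have e12 := (hF.nat 12 (by decide)).trans h12
    refine WP.seq ((wp_edgeLoop hI h1 hδ hR hs' (by omega) e12 e15 er12).mono le_rfl ?_)
    rintro ρ hFρ ⟨⟨R', hR'⟩, hE', hD'⟩
    have hs'' := hs'.frame hFρ (by decide) (by decide)
    have f15 := (hFρ.nat 15 (by decide)).trans e15
    have fr12 := (hFρ.real 12 (by decide)).trans er12
    refine WP.pre_le (by decide) (WP.skip_le (by decide) ⟨⟨R', hR'.congr ?_ rfl rfl⟩,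
      hE.trans hE', fun k' hk' e => ?_, ?_, ?_⟩)
    · simp [Op.apply, Memory.setNat, Memory.setReal]
    · rcases Nat.lt_succ_iff_lt_or_eq.1 hk' with hk' | rfl
      · exact (hD k' hk' e).mono (Ext.refl _ _ _) hE'
      · exact (hD' e).mono hE (Ext.refl _ _ _)
    · simp [Op.apply, Memory.setNat, Memory.setReal, f15, hs''.n4]; ring
    · simp [Op.apply, Memory.setNat, Memory.setReal, fr12, hs''.r11]; ring
  · rintro τ - ⟨hR, hE, hD, -⟩
    exact ⟨hR, hE, hD⟩

theorem wp_levelLoop (hI : I.Admissible) (h1 : I.CyclePreventionI) {δ : ℝ} (hδ : 0 ≤ δ)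
    {J base : ℕ} {σ : Memory} (h : ∃ R, TableInv I δ J base σ R) (hs : SearchRegs I δ J base σ)
    (h12 : σ.nat 12 = 0) :
    WP I levelLoop (fun τ => (∃ R, TableInv I δ J base τ R) ∧ Ext n base σ τ ∧
      ∀ j k, j + k < J → ∀ e, Done I δ base σ j k e τ)
      (J * (J * (m * 38 + 7) + 8) + 2) σ := by
  refine (WP.forLoop (T := 3 + (J * (m * 38 + 7) + 2 + 1)) (fun j τ =>
      (∃ R, TableInv I δ J base τ R) ∧
      Ext n base σ τ ∧ (∀ j' < j, ∀ k < J - j', ∀ e, Done I δ base σ j' k e τ) ∧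
      τ.nat 12 = n * j) hs.n7 hs.n5 (by decide) (by decide)
      (by decide) (by decide) (by decide) ?_ ?_).mono
      (Nat.add_le_add_right (Nat.mul_le_mul_left _ (by omega)) _) ?_
  · obtain ⟨R, hR⟩ := h
    refine ⟨⟨R, hR.congr (by simp [Memory.setNat]) rfl rfl⟩, Ext.refl _ _ _,
      fun e he => absurd he (Nat.not_lt_zero _), ?_⟩
    simpa [Memory.setNat] using h12
  · rintro j hj τ hF hτj ⟨⟨R, hR⟩, hE, hD, e12⟩
    have hs' := hs.frame hF (by decide) (by decide)
    refine WP.pre (os := [_, _, _]) (WP.seq ?_)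
    simp only [List.foldl, Op.apply]
    refine WP.mono (Q := ?Q) (T := J * (m * 38 + 7) + 2) ?h le_rfl ?post
    case h =>
      refine wp_budgetLoop (j := j) hI h1 hδ ⟨R, hR.congr ?_ ?_ ?_⟩ ?_ ?_ ?_ ?_ ?_
      case refine_4 =>
        obtain ⟨a1, a2, a3, a4, a5, a6, a7, a8, a9⟩ := hs'
        constructor <;> simpa [Memory.setNat, Memory.setReal]
      all_goals simp [Memory.setNat, Memory.setReal, e12, hs'.n6, hs'.n7, hτj]
    rintro ρ hFρ ⟨⟨R', hR'⟩, hE', hD'⟩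
    have f12 := hFρ.nat 12 (by decide)
    have f4 := hFρ.nat 4 (by decide)
    simp [Memory.setNat, Memory.setReal, e12, hs'.n4] at f12 f4
    refine WP.op ⟨⟨R', hR'.congr ?_ rfl rfl⟩, hE.trans hE', fun j' hj' k hk e => ?_, ?_⟩
    · simp [Op.apply, Memory.setNat]
    · rcases Nat.lt_succ_iff_lt_or_eq.1 hj' with hj' | rfl
      · exact (hD j' hj' k hk e).mono (Ext.refl _ _ _) hE'
      · exact (hD' k hk e).mono hE (Ext.refl _ _ _)
    · simp [Op.apply, Memory.setNat, f12, f4]; ring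
  · rintro τ - ⟨hR, hE, hD, -⟩
    exact ⟨hR, hE, fun j k hjk e => hD j (by omega) k (by omega) e⟩

/-- The table covers all routes with at most `r` edges, where `κ` tells the budgets. -/
def Covers (I : Instance n m) (δ : ℝ) (J base : ℕ) (κ : Fin m × ℝ → ℕ) (r : ℕ) (σ : Memory) :
    Prop :=
  ∀ (Q : Route m) (v : Fin n), I.IsPath I.s v Q → I.ChargeOK I.B₀ Q → Q.length ≤ r →
    (∀ p ∈ Q, I.fuel p.1 p.2 ≤ κ p * δ) → (Q.map κ).sum < J →
    Has base σ v (Q.map κ).sum (I.B₀ - I.totalBatt Q)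

/-- The Bellman step: the route without its last edge is covered at the sum of its budgets, and one
pass extends that entry by the last edge with its own budget. -/
theorem Covers.succ {δ : ℝ} {J base : ℕ} {κ : Fin m × ℝ → ℕ} {r : ℕ} {σ τ : Memory}
    (h : Covers I δ J base κ r σ) (hE : Ext n base σ τ)
    (hD : ∀ j k, j + k < J → ∀ e, Done I δ base σ j k e τ) : Covers I δ J base κ (r + 1) τ := by
  intro Q v hp hc hl hf hJ
  rcases List.eq_nil_or_concat Q with rfl | ⟨Q, p, rfl⟩
  · exact hE _ _ _ (h [] v hp hc (Nat.zero_le _) hf hJ)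
  · rw [List.concat_eq_append] at *
    obtain ⟨w, hw, hpw⟩ := Instance.isPath_append.1 hp
    obtain ⟨hcQ, hcp⟩ := Instance.chargeOK_append.1 hc
    simp only [List.map_append, List.sum_append, List.map_cons, List.map_nil, List.sum_cons,
      List.sum_nil, add_zero, List.length_append, List.length_cons, List.length_nil] at hJ hl ⊢
    have hQ := h Q w hw hcQ (by omega) (fun q hq => hf q (by simp [hq])) (by omega)
    obtain ⟨rfl, hpm, rfl⟩ := hpw
    rw [Instance.totalBatt_append, Instance.totalBatt_cons, Instance.totalBatt_nil, add_zero,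
      ← sub_sub]
    exact hD _ _ hJ p.1 _ _ hQ hpm (hf p (by simp)) hcp.1

theorem wp_roundLoop (hI : I.Admissible) (h1 : I.CyclePreventionI) {δ : ℝ} (hδ : 0 ≤ δ)
    {J base : ℕ} {κ : Fin m × ℝ → ℕ} {σ : Memory} (h : ∃ R, TableInv I δ J base σ R)
    (hs : SearchRegs I δ J base σ) (h0 : Covers I δ J base κ 0 σ) :
    WP I roundLoop (fun τ => (∃ R, TableInv I δ J base τ R) ∧ Covers I δ J base κ n τ)
      (n * (J * (J * (m * 38 + 7) + 8) + 5) + 2) σ := by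
  refine (WP.forLoop (T := 1 + (J * (J * (m * 38 + 7) + 8) + 2)) (fun r τ =>
      (∃ R, TableInv I δ J base τ R) ∧ Covers I δ J base κ r τ) hs.n4 hs.n5 (by decide) (by decide)
      (by decide) (by decide) (by decide) ?_ ?_).mono
      (Nat.add_le_add_right (Nat.mul_le_mul_left _ (by omega)) _) ?_
  · obtain ⟨R, hR⟩ := h
    exact ⟨⟨R, hR.congr (by simp [Memory.setNat]) rfl rfl⟩, h0⟩
  · rintro r hr τ hF hτr ⟨⟨R, hR⟩, hC⟩
    have hs' := hs.frame hF (by decide) (by decide)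
    refine WP.seq (WP.op ?_)
    simp only [Op.apply]
    refine WP.mono (Q := ?Q) (T := J * (J * (m * 38 + 7) + 8) + 2) ?h le_rfl ?post
    case h =>
      refine wp_levelLoop hI h1 hδ ⟨R, hR.congr ?_ ?_ ?_⟩ ?_ ?_
      case refine_4 =>
        obtain ⟨a1, a2, a3, a4, a5, a6, a7, a8, a9⟩ := hs'
        constructor <;> simpa [Memory.setNat]
      all_goals simp [Memory.setNat]
    rintro ρ - ⟨⟨R', hR'⟩, hE', hD'⟩
    exact ⟨⟨R', hR'.congr (by simp [Memory.setNat]) rfl rfl⟩,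
      Covers.succ (σ := τ) hC hE' hD'⟩
  · rintro τ - h
    exact h

/-! ### Output of a route and the number of labels -/

/-- Write the route of label `22`, which has length `23`, from its end to its start. -/
def outputLoop : Program :=
  loop (.natLt 6 23) (pre [.natSub 23 23 5, .natLoad 24 4 22, .natStore 0 23 24, .realLoad 16 2 22,
    .realStore 0 23 16, .natLoad 22 3 22] skip)

/-- Write the route of label `22`. -/
def output : Program :=
  pre [.natLoad 23 5 22, .natAdd 0 23 5] (seq outputLoop (op (.natConst 26 1)))

/-- Search for a route with fuel consumption about `10`. -/
def search : Program :=
  pre [.realDiv 11 10 9, .natAdd 8 9 6, .natAdd 9 9 5, .natStore 1 2 9, .natStore 2 2 9,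
    .natStore 5 9 6, .realStore 1 9 1]
    (seq roundLoop (pre [.natLoad 22 2 3] (cond (.natLt 8 22) output (op (.natConst 26 0)))))

/-- The registers written by other operations than incrementing register `9`. -/
def Op.otherDst : Op → List ℕ
  | natAdd 9 9 5 => []
  | o => o.natDst

/-- The label counter changes only by adding register 5, which is one, so the number of labels
created is at most the time spent. -/
theorem Exec.label_le {c : Program} {σ τ : Memory} {t : ℕ} (h : Exec I c σ τ t)
    (h9 : 9 ∉ c.collect Op.otherDst) (h5 : 5 ∉ c.collect Op.natDst) (h1 : σ.nat 5 = 1) :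
    τ.nat 9 ≤ σ.nat 9 + t := by
  induction h with
  | op o σ =>
    by_cases ho : o = .natAdd 9 9 5
    · subst ho
      simp [Op.apply, Memory.setNat, h1]
    · have : 9 ∉ (Program.op o).collect Op.natDst := by
        have h3 : o.otherDst = o.natDst := by
          unfold Op.otherDst
          split
          · exact absurd rfl ho
          · rfl
        simpa [Program.collect, h3] using h9
      rw [(Frame.op (I := I) o σ).nat 9 this]
      exact Nat.le_succ _
  | seq h h' ih ih' =>
    simp only [Program.collect, List.mem_append, not_or] at h9 h5
    have h3 := ih h9.1 h5.1 h1
    have h4 := ih' h9.2 h5.2 ((h.frame.nat 5 h5.1).trans h1)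
    omega
  | condTrue _ _ ih =>
    simp only [Program.collect, List.mem_append, not_or] at h9 h5
    have := ih h9.1 h5.1 h1
    omega
  | condFalse _ _ ih =>
    simp only [Program.collect, List.mem_append, not_or] at h9 h5
    have := ih h9.2 h5.2 h1
    omega
  | loopEnd _ => exact Nat.le_succ _
  | loopStep _ h h' ih ih' =>
    have h3 := ih h9 h5 h1
    have h4 := ih' h9 h5 ((h.frame.nat 5 h5).trans h1)
    omega

theorem WP.label_le {c : Program} {Q : Memory → Prop} {T : ℕ} {σ : Memory} (h : WP I c Q T σ)
    (h9 : 9 ∉ c.collect Op.otherDst) (h5 : 5 ∉ c.collect Op.natDst) (h1 : σ.nat 5 = 1) :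
    WP I c (fun τ => Q τ ∧ τ.nat 9 ≤ σ.nat 9 + T) T σ := by
  obtain ⟨τ, t, he, ht, hq⟩ := h
  exact ⟨τ, t, he, ht, hq, (he.label_le h9 h5 h1).trans (by omega)⟩

/-- Predecessors yield the route backwards. S is the suffix already written, in its final position
because the length of the route is known beforehand. -/
theorem wp_outputLoop {R : ℕ → Route m} {base c : ℕ} {pred edge : ℕ → ℕ} {param : ℕ → ℝ}
    (hR : ∀ x, base < x → x ≤ c → R x = [] ∨
      (base < pred x ∧ pred x < x) ∧ ∃ p : Fin m × ℝ,
        R x = R (pred x) ++ [p] ∧ edge x = p.1 ∧ param x = p.2)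
    {S : Route m} {σ : Memory} {x : ℕ} (hx : base < x) (hx' : x ≤ c) (h3 : σ.natArr 3 = pred)
    (h4 : σ.natArr 4 = edge) (h2 : σ.realArr 2 = param) (h5 : σ.nat 5 = 1) (h6 : σ.nat 6 = 0)
    (h22 : σ.nat 22 = x) (h23 : σ.nat 23 = (R x).length)
    (hS : ∀ i (h : i < S.length), σ.natArr 0 ((R x).length + i) = (S[i].1 : ℕ) ∧
      σ.realArr 0 ((R x).length + i) = S[i].2) :
    WP I outputLoop (fun τ => ∀ i (h : i < (R x ++ S).length),
      τ.natArr 0 i = ((R x ++ S)[i].1 : ℕ) ∧ τ.realArr 0 i = (R x ++ S)[i].2)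
      ((R x).length * 8 + 1) σ := by
  induction x using Nat.strong_induction_on generalizing σ S with
  | _ x ih =>
    rcases hR x hx hx' with h0 | ⟨⟨hb, hlt⟩, p, hp, he, ha⟩
    · rw [h0] at hS h23 ⊢
      refine (WP.loopEnd ?_ ?_).mono le_rfl fun _ _ h => h
      · simp [Test.Holds, h6, h23]
      · simpa using hS
    · have hlen : (R x).length = (R (pred x)).length + 1 := by rw [hp]; simp
      refine (WP.loopStep (T := 7) (U := (R (pred x)).length * 8 + 1) ?_ ?_).mono
        (by rw [hlen]; omega) fun _ _ h => h
      · simp [Test.Holds, h6, h23, hlen]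
      · refine WP.pre_le (by decide) (WP.skip_le (by decide) ?_)
        have hS' : R x ++ S = R (pred x) ++ (p :: S) := by rw [hp]; simp
        rw [hS']
        apply ih (pred x) hlt hb (hlt.le.trans hx') <;>
          simp [Op.apply, Memory.setNat, Memory.setReal, Memory.setNatArr, Memory.setRealArr,
            h2, h3, h4, h5, h6, h22, h23, hlen, he, ha]
        intro i hi
        rcases i with _ | i
        · simp
        · have := hS i (by simpa using hi)
          rw [hlen] at this
          simpa [add_assoc, add_comm 1] using this

/-! ### One search with a given fuel bound -/

/-- The registers that are constant after the initialization, and the freshness of labels. -/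
structure MainInv (I : Instance n m) (M : ℕ) (σ : Memory) : Prop where
  n1 : σ.nat 1 = m
  n2 : σ.nat 2 = I.s
  n3 : σ.nat 3 = I.t
  n4 : σ.nat 4 = n
  n5 : σ.nat 5 = 1
  n6 : σ.nat 6 = 0
  n7 : σ.nat 7 = M + n + 1
  r1 : σ.real 1 = I.B₀
  r2 : σ.real 2 = I.cap
  r5 : σ.real 5 = 0
  r9 : σ.real 9 = M
  best_le : ∀ i, σ.natArr 1 i ≤ σ.nat 9
  last_le : ∀ i, σ.natArr 2 i ≤ σ.nat 9

/-- Time for filling the table. -/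
def roundTime (n m J : ℕ) : ℕ := n * (J * (J * (m * 38 + 7) + 8) + 5) + 2

/-- Rounding up to multiples of X/M costs at most one unit per edge, so M units grow to at most M +
n. This is why there are M + n + 1 levels. -/
theorem Instance.exists_budgets {M : ℕ} (hM : 0 < M) {X : ℝ} (hI : I.Admissible)
    {Q : Route m} (hQ : ∀ p ∈ Q, p.2 ∈ Set.Icc (0 : ℝ) 1) (hf : I.totalFuel Q ≤ X)
    (hl : Q.length ≤ n) :
    (∀ p ∈ Q, I.fuel p.1 p.2 ≤ ⌈I.fuel p.1 p.2 / (X / M)⌉₊ * (X / M)) ∧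
      (Q.map fun p => ⌈I.fuel p.1 p.2 / (X / M)⌉₊).sum < M + n + 1 := by
  have hM' : (0 : ℝ) < M := by exact_mod_cast hM
  have hfQ := hI.totalFuel_nonneg hQ
  rcases (hfQ.trans hf).eq_or_lt with h0 | h0
  -- For X = 0 the unit is 0 and division by it gives budgets 0, which suffice because every edge of
  -- the route is fuel-free.
  · subst h0
    refine ⟨fun p hp => ?_, ?_⟩
    · simpa using (hI.fuel_le_totalFuel hQ hp).trans hf
    · simp
  · have hδ : 0 < X / M := div_pos h0 hM'
    refine ⟨fun p hp => ?_, ?_⟩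
    · rw [← div_le_iff₀ hδ]; exact Nat.le_ceil _
    · have key : ∀ Q : Route m, (∀ p ∈ Q, p.2 ∈ Set.Icc (0 : ℝ) 1) →
          ((Q.map fun p => ⌈I.fuel p.1 p.2 / (X / M)⌉₊).sum : ℝ) ≤
            I.totalFuel Q / (X / M) + Q.length := by
        intro Q
        induction Q with
        | nil => simp
        | cons p Q ih =>
          intro hQ
          have h3 := ih fun q hq => hQ q (List.mem_cons_of_mem _ hq)
          have h4 := (Nat.ceil_lt_add_one (div_nonneg
            (hI.fuel_nonneg p.1 p.2 (hQ p List.mem_cons_self)) hδ.le)).le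
          simp only [List.map_cons, List.sum_cons, Nat.cast_add, Instance.totalFuel_cons,
            List.length_cons, add_div, Nat.cast_one]
          linarith
      have h3 := key Q hQ
      have h4 : I.totalFuel Q / (X / M) ≤ M := by
        rw [div_le_iff₀ hδ, mul_div_cancel₀ _ hM'.ne']
        exact hf
      have h5 : (Q.length : ℝ) ≤ n := by exact_mod_cast hl
      have h6 : ((Q.map fun p => ⌈I.fuel p.1 p.2 / (X / M)⌉₊).sum : ℝ) ≤ ((M + n : ℕ) : ℝ) := by
        push_cast at h3 ⊢
        linarith
      have : (Q.map fun p => ⌈I.fuel p.1 p.2 / (X / M)⌉₊).sum ≤ M + n := by exact_mod_cast h6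
      omega

theorem wp_output {δ : ℝ} {J base : ℕ} {σ : Memory} {R : ℕ → Route m}
    (hR : TableInv I δ J base σ R) (h5 : σ.nat 5 = 1) (h6 : σ.nat 6 = 0)
    (hb : base < σ.nat 22) (hc : σ.nat 22 ≤ σ.nat 9) :
    WP I output (fun τ => τ.nat 26 = 1 ∧ τ.Shows (R (σ.nat 22)))
      ((R (σ.nat 22)).length * 8 + 4) σ := by
  refine (WP.pre (T := (R (σ.nat 22)).length * 8 + 1 + 1) (WP.seq ?_)).mono
    (by simp; omega) fun _ _ h => h
  have hl := hR.len _ hb hc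
  refine WP.mono (Q := ?Q) (T := (R (σ.nat 22)).length * 8 + 1) ?h le_rfl ?post
  case h =>
    refine wp_outputLoop (S := []) hR.chain hb hc ?_ ?_ ?_ ?_ ?_ ?_ ?_ ?_ <;>
      simp [Op.apply, Memory.setNat, h5, h6, hl]
  intro τ hF hτ
  have h0 := hF.nat 0 (by decide)
  simp only [List.append_nil] at hτ
  refine WP.op ⟨by simp [Op.apply, Memory.setNat], ?_, hτ⟩
  simp [Op.apply, Memory.setNat, h0, h5, hl]

/-- The table is never cleared. Raising the base to the present label counter makes all old entries
count as empty; only the source at level 0, in cell s, gets a new label with the empty route. -/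
theorem TableInv.initial {δ : ℝ} (hδ : 0 ≤ δ) {M : ℕ} {σ τ : Memory} (hσ : MainInv I M σ)
    (h9 : τ.nat 9 = σ.nat 9 + 1)
    (h1 : τ.natArr 1 = Function.update (σ.natArr 1) I.s (σ.nat 9 + 1))
    (h2 : τ.natArr 2 = Function.update (σ.natArr 2) I.s (σ.nat 9 + 1))
    (h5 : τ.natArr 5 (σ.nat 9 + 1) = 0) (hr : τ.realArr 1 (σ.nat 9 + 1) = I.B₀) :
    TableInv I δ (M + n + 1) (σ.nat 9) τ (fun _ => []) := by
  have hJ : (0 : ℝ) ≤ ((M + n + 1 : ℕ) : ℝ) - 1 := by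
    push_cast
    linarith [M.cast_nonneg (α := ℝ), n.cast_nonneg (α := ℝ)]
  have huniq : ∀ x, σ.nat 9 < x → x ≤ τ.nat 9 → x = σ.nat 9 + 1 := fun x h h' => by omega
  constructor
  · intro i
    have := hσ.best_le i
    rw [h1, h9, Function.update_apply]; split_ifs <;> omega
  · intro i
    have := hσ.last_le i
    rw [h2, h9, Function.update_apply]; split_ifs <;> omega
  · intro x hx hx'
    rw [huniq x hx hx', h5]; rfl
  · exact fun x _ _ => Or.inl rfl
  · intro x hx hx'
    rw [huniq x hx hx', hr]; simp
  · exact fun _ _ _ => trivial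
  · intro v j hj hb
    refine ⟨?_, by simpa using mul_nonneg j.cast_nonneg hδ⟩
    rw [h1] at hb
    by_cases hv : (v : ℕ) + n * j = I.s
    · exact (add_mul_inj (j := 0) (by simpa using hv)).1.symm
    · rw [Function.update_of_ne hv] at hb
      exact absurd (hσ.best_le _) (not_le.2 hb)
  · intro v hb
    refine ⟨?_, by simpa using mul_nonneg hJ hδ⟩
    rw [h2] at hb
    by_cases hv : (v : ℕ) = I.s
    · exact (Fin.ext hv).symm
    · rw [Function.update_of_ne hv] at hb
      exact absurd (hσ.last_le _) (not_le.2 hb)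
  · intro v j hj hb
    rw [h1] at hb
    by_cases hv : (v : ℕ) + n * j = I.s
    · have hvs : v = I.s := (add_mul_inj (i := j) (j := 0) (by simpa using hv)).1
      rw [hvs, h2]; simp
    · rw [Function.update_of_ne hv] at hb
      exact absurd (hσ.best_le _) (not_le.2 hb)

/-- Success or failure of a search for a route with fuel consumption `X`. -/
def SearchResult (I : Instance n m) (M : ℕ) (X : ℝ) (σ τ : Memory) : Prop :=
  (τ.nat 26 = 1 ∧ ∃ P, τ.Shows P ∧ I.Feasible P ∧ I.totalFuel P ≤ (1 + n / M) * X) ∨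
    (τ.nat 26 = 0 ∧ τ.nat 0 = σ.nat 0 ∧ τ.natArr 0 = σ.natArr 0 ∧ τ.realArr 0 = σ.realArr 0 ∧
      ∀ Q, I.Feasible Q → X < I.totalFuel Q)

theorem wp_search (hI : I.Admissible) (h1 : I.CyclePreventionI) (h2 : I.CyclePreventionII)
    {M : ℕ} (hM : 0 < M) {X : ℝ} (hX : 0 ≤ X) {σ : Memory} (hσ : MainInv I M σ)
    (h10 : σ.real 10 = X) :
    WP I search (fun τ => MainInv I M τ ∧ SearchResult I M X σ τ)
      (9 * roundTime n m (M + n + 1) + 20) σ := by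
  have hM' : (0 : ℝ) < M := by exact_mod_cast hM
  have hδ : 0 ≤ X / M := div_nonneg hX hM'.le
  set T := roundTime n m (M + n + 1) with hT
  have main : WP I search (fun τ => (∀ i, τ.natArr 1 i ≤ τ.nat 9) ∧ (∀ i, τ.natArr 2 i ≤ τ.nat 9) ∧
      SearchResult I M X σ τ) (9 * T + 20) σ := by
    -- At most T labels arise while the table is filled in time T, so the route written has at most
    -- T edges, at eight steps each.
    refine (WP.pre (T := T + (T * 8 + 7)) (WP.seq ?_)).mono (by simp; omega) fun _ _ h => h
    set σ' := List.foldl (fun σ o => Op.apply I σ o) σ [.realDiv 11 10 9, .natAdd 8 9 6,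
      .natAdd 9 9 5, .natStore 1 2 9, .natStore 2 2 9, .natStore 5 9 6, .realStore 1 9 1] with hσ'
    have e9 : σ'.nat 9 = σ.nat 9 + 1 := by
      simp [hσ', Op.apply, Memory.setNat, Memory.setReal, Memory.setNatArr, Memory.setRealArr,
        hσ.n5]
    have hs : SearchRegs I (X / M) (M + n + 1) (σ.nat 9) σ' := by
      constructor <;> simp [hσ', Op.apply, Memory.setNat, Memory.setReal, Memory.setNatArr,
        Memory.setRealArr, hσ.n1, hσ.n4, hσ.n5, hσ.n6, hσ.n7, hσ.r2, hσ.r5, hσ.r9, h10]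
    have e3 : σ'.nat 3 = I.t := by
      simp [hσ', Op.apply, Memory.setNat, Memory.setReal, Memory.setNatArr, Memory.setRealArr,
        hσ.n3]
    have e0 : σ'.nat 0 = σ.nat 0 ∧ σ'.natArr 0 = σ.natArr 0 ∧ σ'.realArr 0 = σ.realArr 0 := by
      refine ⟨?_, ?_, ?_⟩ <;> simp [hσ', Op.apply, Memory.setNat, Memory.setReal,
        Memory.setNatArr, Memory.setRealArr]
    have a1 : σ'.natArr 1 = Function.update (σ.natArr 1) I.s (σ.nat 9 + 1) := by
      simp [hσ', Op.apply, Memory.setNat, Memory.setReal, Memory.setNatArr, Memory.setRealArr,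
        hσ.n5, hσ.n2]
    have a2 : σ'.natArr 2 = Function.update (σ.natArr 2) I.s (σ.nat 9 + 1) := by
      simp [hσ', Op.apply, Memory.setNat, Memory.setReal, Memory.setNatArr, Memory.setRealArr,
        hσ.n5, hσ.n2]
    have a5 : σ'.natArr 5 (σ.nat 9 + 1) = 0 := by
      simp [hσ', Op.apply, Memory.setNat, Memory.setReal, Memory.setNatArr, Memory.setRealArr,
        hσ.n5, hσ.n6]
    have b1 : σ'.realArr 1 (σ.nat 9 + 1) = I.B₀ := by
      simp [hσ', Op.apply, Memory.setNat, Memory.setReal, Memory.setNatArr, Memory.setRealArr,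
        hσ.n5, hσ.r1]
    clear_value σ'
    have hinit := TableInv.initial hδ hσ e9 a1 a2 a5 b1
    refine WP.mono (T := T) (WP.label_le (wp_roundLoop
      (κ := fun p => ⌈I.fuel p.1 p.2 / (X / M)⌉₊) hI h1 hδ ⟨_, hinit⟩ hs ?_) (by decide)
      (by decide) hs.n5) le_rfl ?_
    · intro Q v hp hc hl hf hJ
      obtain rfl := List.length_eq_zero_iff.1 (Nat.le_zero.1 hl)
      obtain rfl : I.s = v := hp
      simp only [Has, List.map_nil, List.sum_nil, mul_zero, add_zero, a1, Function.update_self, b1]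
      simp
    rintro τ hF ⟨⟨⟨R, hR⟩, hC⟩, hτ9⟩
    have hs' := hs.frame hF (by decide) (by decide)
    have f3 := (hF.nat 3 (by decide)).trans e3
    have f0 := (hF.nat 0 (by decide)).trans e0.1
    have fa := (hF.natArr 0 (by decide)).trans e0.2.1
    have fb := (hF.realArr 0 (by decide)).trans e0.2.2
    refine (WP.pre (T := T * 8 + 5 + 1) (WP.cond (fun hlt => ?_) fun hlt =>
      (WP.op ?_).mono (Nat.succ_le_succ (Nat.zero_le _)) fun _ _ h => h)).mono
      (by simp; omega) fun _ _ h => h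
    · simp [Test.Holds, Op.apply, Memory.setNat, hs'.n8, f3] at hlt
      have hle := hR.last_le I.t
      have hlen := hR.length_lt hlt hle
      refine WP.mono (Q := ?Q) (T := (R (τ.natArr 2 I.t)).length * 8 + 4) ?h
        (by change _ ≤ σ'.nat 9 + T at hτ9; omega) ?post
      case h =>
        have := wp_output (I := I) (σ := τ.setNat 22 (τ.natArr 2 I.t)) (R := R)
          (hR.congr (by simp [Memory.setNat]) rfl rfl)
          (by simp [Memory.setNat, hs'.n5]) (by simp [Memory.setNat, hs'.n6])
          (by simpa [Memory.setNat] using hlt) (by simpa [Memory.setNat] using hle)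
        simpa [Op.apply, Memory.setNat, f3] using this
      intro ρ hFρ hρ
      have g9 := hFρ.nat 9 (by decide)
      have g1 := hFρ.natArr 1 (by decide)
      have g2 := hFρ.natArr 2 (by decide)
      simp [Op.apply, Memory.setNat] at g9 g1 g2
      refine ⟨fun i => by rw [g1, g9]; exact hR.best_le i, fun i => by
        rw [g2, g9]; exact hR.last_le i, Or.inl ⟨hρ.1, _, hρ.2, ?_⟩⟩
      obtain ⟨hp, hf⟩ := hR.last I.t hlt
      refine ⟨⟨hp, hR.ok _ hlt hle⟩, hf.trans (le_of_eq ?_)⟩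
      -- The highest level is M + n, and (M + n) · X/M = (1 + n/M) X.
      push_cast
      field_simp
      ring
    · simp [Test.Holds, Op.apply, Memory.setNat, hs'.n8, f3] at hlt
      refine ⟨fun i => ?_, fun i => ?_, Or.inr ⟨?_, ?_, fa, fb, fun Q hQ => ?_⟩⟩
      · simpa [Op.apply, Memory.setNat] using hR.best_le i
      · simpa [Op.apply, Memory.setNat] using hR.last_le i
      · simp [Op.apply, Memory.setNat]
      · simpa [Op.apply, Memory.setNat] using f0
      · by_contra! hle
        -- A feasible path of fuel at most X could be taken short; its rounded budgets would fit the
        -- levels, and the target would have a label.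
        obtain ⟨P, hP, hl, hf⟩ := hI.exists_short h1 h2 hQ
        obtain ⟨hk, hsum⟩ := Instance.exists_budgets hM hI hP.1.param_mem (hf.trans hle) hl.le
        have := (hC P I.t hP.1 hP.2 hl.le hk hsum).1
        exact absurd (hR.best_last _ _ hsum this) (not_lt.2 hlt)
  refine main.mono le_rfl fun τ hF hτ => ⟨?_, hτ.2.2⟩
  obtain ⟨b1, b2, b3, b4, b5, b6, b7, b8, b9, b10, b11, -, -⟩ := hσ
  constructor
  · rwa [hF.nat _ (by decide)]
  · rwa [hF.nat _ (by decide)]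
  · rwa [hF.nat _ (by decide)]
  · rwa [hF.nat _ (by decide)]
  · rwa [hF.nat _ (by decide)]
  · rwa [hF.nat _ (by decide)]
  · rwa [hF.nat _ (by decide)]
  · rwa [hF.real _ (by decide)]
  · rwa [hF.real _ (by decide)]
  · rwa [hF.real _ (by decide)]
  · rwa [hF.real _ (by decide)]
  · exact hτ.1
  · exact hτ.2.1

/-! ### Initialization and the geometric search for the optimum -/

/-- Count the budget levels: `1 + 2 * n / ε₁`, up to rounding. -/
def countLevels : Program :=
  loop (.realLt 8 7) (pre [.realAdd 8 8 3, .realAdd 9 9 4, .natAdd 7 7 5] skip)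

/-- Initialize the constants. -/
def prologue : Program :=
  pre [.natAdd 4 0 6, .natConst 0 0, .natConst 5 1, .realConst 4 1, .realConst 3 3, .realAdd 3 3 0,
    .realDiv 3 0 3, .realAdd 6 4 3, .natAdd 7 4 5]
    (seq (forLoop 25 4 (op (.realAdd 7 7 4)))
      (seq countLevels (forLoop 16 1 (pre [.evalFuel 16 16 4, .realAdd 20 20 16] skip))))

/-- Search with smaller and smaller bounds, until there is no route. -/
def mainLoop : Program := loop (.natLt 6 26) (seq search (op (.realDiv 10 10 6)))

/-- The approximation scheme. -/
def scheme : Program :=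
  seq prologue (seq search (cond (.natLt 6 26) skip
    (pre [.realMul 10 7 20, .natConst 26 1] mainLoop)))

theorem wp_prologue {ε ε₁ : ℝ} (hε₁ : ε₁ = ε / (3 + ε)) (h0 : 0 < ε₁) :
    WP I prologue (fun τ => MainInv I ⌈n / ε₁⌉₊ τ ∧ τ.nat 0 = 0 ∧ τ.real 6 = 1 + ε₁ ∧
      τ.real 7 = n ∧ τ.real 10 = 0 ∧ τ.real 20 = I.fullFuel)
      (3 * n + 5 * ⌈n / ε₁⌉₊ + 5 * m + 14) (inputMemory I ε) := by
  set M := ⌈n / ε₁⌉₊ with hM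
  refine (WP.pre (T := n * (1 + 2) + 2 + (M * (4 + 1) + 1 + (m * (3 + 2) + 2))) (WP.seq ?_)).mono
    (by simp; omega) fun _ _ h => h
  set σ := List.foldl (fun σ o => Op.apply I σ o) (inputMemory I ε) [.natAdd 4 0 6,
    .natConst 0 0, .natConst 5 1, .realConst 4 1, .realConst 3 3, .realAdd 3 3 0,
    .realDiv 3 0 3, .realAdd 6 4 3, .natAdd 7 4 5] with hσ
  have hn : σ.nat 0 = 0 ∧ σ.nat 1 = m ∧ σ.nat 2 = I.s ∧ σ.nat 3 = I.t ∧ σ.nat 4 = n ∧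
      σ.nat 5 = 1 ∧ σ.nat 6 = 0 ∧ σ.nat 7 = n + 1 ∧ σ.nat 9 = 0 := by
    refine ⟨?_, ?_, ?_, ?_, ?_, ?_, ?_, ?_, ?_⟩ <;>
      simp [hσ, Op.apply, Memory.setNat, Memory.setReal, inputMemory]
  have hr : σ.real 1 = I.B₀ ∧ σ.real 2 = I.cap ∧ σ.real 3 = ε₁ ∧ σ.real 4 = 1 ∧ σ.real 5 = 0 ∧
      σ.real 6 = 1 + ε₁ ∧ σ.real 7 = 0 ∧ σ.real 8 = 0 ∧ σ.real 9 = 0 ∧ σ.real 10 = 0 ∧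
      σ.real 20 = 0 := by
    refine ⟨?_, ?_, ?_, ?_, ?_, ?_, ?_, ?_, ?_, ?_, ?_⟩ <;>
      simp [hσ, Op.apply, Memory.setNat, Memory.setReal, inputMemory, hε₁]
  have ha : ∀ k i, σ.natArr k i = 0 := fun k i => by
    simp [hσ, Op.apply, Memory.setNat, Memory.setReal, inputMemory]
  clear_value σ
  obtain ⟨n0, n1, n2, n3, n4, n5, n6, n7, n9⟩ := hn
  obtain ⟨r1, r2, r3, r4, r5, r6, r7, r8, r9, r10, r20⟩ := hr
  refine WP.mono (WP.forLoop (T := 1) (fun i τ => τ.real 7 = i) n4 n5 (by decide) (by decide)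
    (by decide) (by decide) (by decide) ?_ ?_) le_rfl ?_
  · simpa [Memory.setNat] using r7
  · rintro i hi τ hF - hτ
    have e4 := (hF.real 4 (by decide)).trans r4
    exact WP.op (by simp [Op.apply, Memory.setNat, Memory.setReal, hτ, e4])
  intro τ hF hτ7
  have t3 := (hF.real 3 (by decide)).trans r3
  have t4 := (hF.real 4 (by decide)).trans r4
  have t5 := (hF.nat 5 (by decide)).trans n5
  refine WP.seq (WP.mono (WP.loop_count (T := 4) (fun i ρ => ρ.real 8 = i * ε₁ ∧ ρ.real 9 = i ∧
    ρ.nat 7 = n + 1 + i ∧ ρ.real 3 = ε₁ ∧ ρ.real 4 = 1 ∧ ρ.nat 5 = 1 ∧ ρ.real 7 = n) M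
    ?_ ?_ M le_rfl ?_) le_rfl ?_)
  · rintro i ρ ⟨e8, -, -, -, -, -, e7⟩
    simp only [Test.Holds, e8, e7]
    -- Reals cannot be rounded, so M = ⌈n/ε₁⌉ is found by adding up ε₁ until n is reached.
    rw [hM, Nat.lt_ceil, lt_div_iff₀ h0]
  · rintro i hi ρ ⟨e8, e9, en7, e3, e4, e5, e7⟩
    refine WP.pre_le (by decide) (WP.skip_le (by decide) ?_)
    simp only [List.foldl, Op.apply]
    refine ⟨?_, ?_, ?_, ?_, ?_, ?_, ?_⟩ <;>
      simp [Memory.setNat, Memory.setReal, e8, e9, en7, e3, e4, e5, e7, add_mul, add_assoc]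
  · rw [Nat.sub_self]
    refine ⟨?_, ?_, ?_, t3, t4, t5, hτ7⟩
    · rw [hF.real 8 (by decide), r8]; simp
    · rw [hF.real 9 (by decide), r9]; simp
    · rw [hF.nat 7 (by decide), n7]
  rintro ρ hFρ ⟨-, e9, en7, -, e4, e5, e7⟩
  have g1 := (hFρ.nat 1 (by decide)).trans ((hF.nat 1 (by decide)).trans n1)
  refine WP.mono (WP.forLoop (T := 3) (fun i τ => τ.real 20 =
    ∑ k ∈ Finset.range i, atEdge k 0 fun e : Fin m => I.fuel e 1) g1 e5 (by decide) (by decide)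
    (by decide) (by decide) (by decide) ?_ ?_) le_rfl ?_
  · have := (hFρ.real 20 (by decide)).trans ((hF.real 20 (by decide)).trans r20)
    simpa [Memory.setNat] using this
  · intro i hi τ' hF' e16 hτ'
    have e4' := (hF'.real 4 (by decide)).trans e4
    refine WP.pre_le (by decide) (WP.skip_le (by decide) ?_)
    simp [Op.apply, Memory.setNat, Memory.setReal, hτ', e4', e16, Finset.sum_range_succ]
  intro τ' hF' hτ'
  have natEq : ∀ x, x ∉ (forLoop 16 1 (pre [.evalFuel 16 16 4, .realAdd 20 20 16] skip)).collect
      Op.natDst → x ∉ countLevels.collect Op.natDst →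
      x ∉ (forLoop 25 4 (op (.realAdd 7 7 4))).collect Op.natDst → τ'.nat x = σ.nat x :=
    fun x h h' h'' => (hF'.nat x h).trans ((hFρ.nat x h').trans (hF.nat x h''))
  have realEq : ∀ x, x ∉ (forLoop 16 1 (pre [.evalFuel 16 16 4, .realAdd 20 20 16] skip)).collect
      Op.realDst → x ∉ countLevels.collect Op.realDst →
      x ∉ (forLoop 25 4 (op (.realAdd 7 7 4))).collect Op.realDst → τ'.real x = σ.real x :=
    fun x h h' h'' => (hF'.real x h).trans ((hFρ.real x h').trans (hF.real x h''))
  have arrEq : ∀ k i, τ'.natArr k i = 0 := fun k i => by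
    rw [hF'.natArr k (by simp [Program.collect, forLoop, pre, skip, Op.natArrDst]),
      hFρ.natArr k (by simp [countLevels, Program.collect, pre, skip, Op.natArrDst]),
      hF.natArr k (by simp [Program.collect, forLoop, Op.natArrDst]), ha]
  refine ⟨⟨?_, ?_, ?_, ?_, ?_, ?_, ?_, ?_, ?_, ?_, ?_, ?_, ?_⟩, ?_, ?_, ?_, ?_, ?_⟩
  · rw [natEq _ (by decide) (by decide) (by decide), n1]
  · rw [natEq _ (by decide) (by decide) (by decide), n2]
  · rw [natEq _ (by decide) (by decide) (by decide), n3]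
  · rw [natEq _ (by decide) (by decide) (by decide), n4]
  · rw [natEq _ (by decide) (by decide) (by decide), n5]
  · rw [natEq _ (by decide) (by decide) (by decide), n6]
  · rw [hF'.nat 7 (by decide), en7]; omega
  · rw [realEq _ (by decide) (by decide) (by decide), r1]
  · rw [realEq _ (by decide) (by decide) (by decide), r2]
  · rw [realEq _ (by decide) (by decide) (by decide), r5]
  · rw [hF'.real 9 (by decide), e9]
  · intro i; rw [arrEq]; exact Nat.zero_le _
  · intro i; rw [arrEq]; exact Nat.zero_le _
  · rw [natEq _ (by decide) (by decide) (by decide), n0]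
  · rw [realEq _ (by decide) (by decide) (by decide), r6]
  · rw [hF'.real 7 (by decide), e7]
  · rw [realEq _ (by decide) (by decide) (by decide), r10]
  · rw [hτ', Finset.sum_range]
    simp only [atEdge_val, Instance.fullFuel]

theorem MainInv.of_eq {M : ℕ} {σ τ : Memory} (h : MainInv I M σ)
    (hn : ∀ x, x < 10 → 0 < x → τ.nat x = σ.nat x) (hr : ∀ x, x < 10 → τ.real x = σ.real x)
    (ha : τ.natArr = σ.natArr) : MainInv I M τ := by
  obtain ⟨b1, b2, b3, b4, b5, b6, b7, b8, b9, b10, b11, b12, b13⟩ := h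
  constructor
  · rwa [hn _ (by decide) (by decide)]
  · rwa [hn _ (by decide) (by decide)]
  · rwa [hn _ (by decide) (by decide)]
  · rwa [hn _ (by decide) (by decide)]
  · rwa [hn _ (by decide) (by decide)]
  · rwa [hn _ (by decide) (by decide)]
  · rwa [hn _ (by decide) (by decide)]
  · rwa [hr _ (by decide)]
  · rwa [hr _ (by decide)]
  · rwa [hr _ (by decide)]
  · rwa [hr _ (by decide)]
  · rwa [hn _ (by decide) (by decide), ha]
  · rwa [hn _ (by decide) (by decide), ha]

/-- N bounds the successful searches still to come: dividing X by q lowers N by one in `hN`. The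
path on display was found with bound qX, hence has fuel at most q · qX. As soon as X fails, every
feasible path needs more than X, and q² ≤ 1 + ε finishes. A failing search leaves the displayed path
untouched. -/
theorem wp_mainLoop (hI : I.Admissible) (h1 : I.CyclePreventionI) (h2 : I.CyclePreventionII)
    {M : ℕ} (hM : 0 < M) {ε q : ℝ} (hq : 1 ≤ q) (hMq : 1 + n / M ≤ q) (hqε : q * q ≤ 1 + ε) (N : ℕ)
    {X : ℝ} (hX : 0 ≤ X) {σ : Memory} (hσ : MainInv I M σ) (h10 : σ.real 10 = X)
    (h6 : σ.real 6 = q) (h26 : σ.nat 26 = 1)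
    (hN : ∀ Q, I.Feasible Q → q * X < q ^ N * I.totalFuel Q)
    (hout : (σ.nat 0 = 0 ∧ ∀ Q, I.Feasible Q → ∃ Q, I.Feasible Q ∧ I.totalFuel Q ≤ X) ∨
      ∃ P, σ.Shows P ∧ I.Feasible P ∧ I.totalFuel P ≤ q * q * X) :
    WP I mainLoop (IsApproxAnswer I ε)
      ((N + 1) * (9 * roundTime n m (M + n + 1) + 22) + 1) σ := by
  have hq0 : 0 < q := one_pos.trans_le hq
  set S := 9 * roundTime n m (M + n + 1) + 20 with hS
  have hS2 : 9 * roundTime n m (M + n + 1) + 22 = S + 2 := rfl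
  induction N generalizing X σ with
  | zero =>
    refine (WP.loopStep (T := S + 1) (U := 1) (by simp [Test.Holds, h26, hσ.n6])
      (WP.seq (WP.mono (wp_search hI h1 h2 hM hX hσ h10) le_rfl ?_))).mono (by omega)
      fun _ _ h => h
    rintro τ hF ⟨hτ, hres⟩
    refine WP.op ?_
    rcases hres with ⟨-, P, hsh, hP, hf⟩ | ⟨hf26, h0, ha, hra, hlt⟩
    -- For N = 0 every feasible path needs more than qX, so the search cannot succeed.
    · have := hN P hP
      have := mul_le_mul_of_nonneg_right hMq hX
      simp only [pow_zero, one_mul] at *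
      linarith
    · refine WP.loopEnd (by simp [Test.Holds, Op.apply, Memory.setReal, hf26]) ?_
      rcases hout with ⟨hs0, hex⟩ | ⟨P, hsh, hP, hf⟩
      · refine Or.inr ⟨?_, fun Q hQ => ?_⟩
        · simp [Memory.ShowsNone, Op.apply, Memory.setReal, h0, hs0]
        · obtain ⟨Q, hQ, hf⟩ := hex Q hQ
          exact absurd (hlt Q hQ) (not_lt.2 hf)
      · refine Or.inl ⟨P, ?_, hP, fun Q hQ => ?_⟩
        · simpa [Memory.Shows, Op.apply, Memory.setReal, h0, ha, hra] using hsh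
        · have := hlt Q hQ
          calc I.totalFuel P ≤ q * q * X := hf
            _ ≤ (1 + ε) * I.totalFuel Q :=
              mul_le_mul hqε this.le hX (by nlinarith)
  | succ N ih =>
    refine (WP.loopStep (T := S + 1) (U := (N + 1) * (S + 2) + 1)
      (by simp [Test.Holds, h26, hσ.n6])
      (WP.seq (WP.mono (wp_search hI h1 h2 hM hX hσ h10) le_rfl ?_))).mono
      (by rw [add_mul (N + 1) 1, hS2]; omega) fun _ _ h => h
    rintro τ hF ⟨hτ, hres⟩
    have t6 := (hF.real 6 (by decide)).trans h6
    have t10 := (hF.real 10 (by decide)).trans h10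
    refine WP.op ?_
    rcases hres with ⟨hf26, P, hsh, hP, hf⟩ | ⟨hf26, h0, ha, hra, hlt⟩
    · refine ih (X := X / q) (div_nonneg hX hq0.le) (hτ.of_eq ?_ ?_ rfl) ?_ ?_ ?_ ?_
        (Or.inr ⟨P, hsh, hP, ?_⟩)
      · intro x _ _; rfl
      · intro x hx
        simp [Op.apply, Memory.setReal, Function.update_of_ne hx.ne]
      · simp [Op.apply, Memory.setReal, t10, t6]
      · simpa [Op.apply, Memory.setReal] using t6
      · simpa [Op.apply, Memory.setReal] using hf26
      · intro Q hQ
        have := hN Q hQ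
        rw [pow_succ', mul_assoc] at this
        rw [mul_div_cancel₀ _ hq0.ne']
        exact lt_of_mul_lt_mul_left this hq0.le
      · rw [mul_assoc, mul_div_cancel₀ _ hq0.ne']
        exact hf.trans (mul_le_mul_of_nonneg_right hMq hX)
    · refine (WP.loopEnd (by simp [Test.Holds, Op.apply, Memory.setReal, hf26]) ?_).mono
        (Nat.succ_le_succ (Nat.zero_le _)) fun _ _ h => h
      rcases hout with ⟨hs0, hex⟩ | ⟨P, hsh, hP, hf⟩
      · refine Or.inr ⟨?_, fun Q hQ => ?_⟩
        · simp [Memory.ShowsNone, Op.apply, Memory.setReal, h0, hs0]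
        · obtain ⟨Q, hQ, hf⟩ := hex Q hQ
          exact absurd (hlt Q hQ) (not_lt.2 hf)
      · refine Or.inl ⟨P, ?_, hP, fun Q hQ => ?_⟩
        · simpa [Memory.Shows, Op.apply, Memory.setReal, h0, ha, hra] using hsh
        · have := hlt Q hQ
          calc I.totalFuel P ≤ q * q * X := hf
            _ ≤ (1 + ε) * I.totalFuel Q :=
              mul_le_mul hqε this.le hX (by nlinarith)

theorem Instance.Admissible.totalFuel_le_length_mul (hI : I.Admissible) {P : Route m}
    (hP : ∀ p ∈ P, p.2 ∈ Set.Icc (0 : ℝ) 1) : I.totalFuel P ≤ P.length * I.fullFuel := by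
  induction P with
  | nil => simp
  | cons p P ih =>
    have h3 := ih fun q hq => hP q (List.mem_cons_of_mem _ hq)
    have h4 := hI.fuel_le_fullFuel p.1 (hP p List.mem_cons_self)
    rw [Instance.totalFuel_cons, List.length_cons]
    push_cast
    linarith

/-- A success with X = 0 yields a fuel-free path. After its failure all feasible paths have positive
fuel, so the fuel range bounds the starting value n · `I.fullFuel` by n · m · 2^L times the optimum.
Since ⌈1/ε₁⌉ divisions by q at least halve the bound, ⌈1/ε₁⌉ · (1 + n + m + L) successes are enough.
-/
theorem wp_scheme (hI : I.Admissible) (h1 : I.CyclePreventionI) (h2 : I.CyclePreventionII)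
    {ε ε₁ : ℝ} (hε : 0 < ε) (hε₁ : ε₁ = ε / (3 + ε)) {L : ℕ} (hL : I.FuelRange L) :
    WP I scheme (IsApproxAnswer I ε)
      (3 * n + 5 * ⌈n / ε₁⌉₊ + 5 * m + 20 +
        (⌈1 / ε₁⌉₊ * (1 + n + m + L) + 2) *
          (9 * roundTime n m (⌈n / ε₁⌉₊ + n + 1) + 22)) (inputMemory I ε) := by
  have hε0 : 0 < ε₁ := hε₁ ▸ by positivity
  have hε1 : ε₁ ≤ 1 := by rw [hε₁, div_le_one (by linarith)]; linarith
  -- The choice ε₁ = ε/(3 + ε) ensures (1 + ε₁)² ≤ 1 + 3ε₁ ≤ 1 + ε.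
  have hε3 : 3 * ε₁ ≤ ε := by
    rw [hε₁, mul_div_assoc', div_le_iff₀ (by linarith)]; nlinarith
  have hn : 0 < n := I.s.pos
  have hnr : (0 : ℝ) < n := by exact_mod_cast hn
  set M := ⌈n / ε₁⌉₊ with hMdef
  have hM : 0 < M := Nat.ceil_pos.2 (div_pos hnr hε0)
  have hM' : (0 : ℝ) < M := by exact_mod_cast hM
  set q := 1 + ε₁ with hqdef
  have hMq : 1 + n / (M : ℝ) ≤ q := by
    have : (n : ℝ) / ε₁ ≤ M := Nat.le_ceil _
    rw [div_le_iff₀ hε0] at this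
    have : (n : ℝ) / M ≤ ε₁ := by rw [div_le_iff₀ hM']; linarith
    linarith
  have hqε : q * q ≤ 1 + ε := by nlinarith
  set A := ⌈1 / ε₁⌉₊
  set S := 9 * roundTime n m (M + n + 1) + 20 with hS
  have hS2 : 9 * roundTime n m (M + n + 1) + 22 = S + 2 := rfl
  refine (WP.seq (T := 3 * n + 5 * M + 5 * m + 14)
    (U := S + ((2 + ((A * (1 + n + m + L) + 1) * (S + 2) + 1)) + 1))
    (WP.mono (wp_prologue hε₁ hε0) le_rfl ?_)).mono
    (by rw [show A * (1 + n + m + L) + 2 = A * (1 + n + m + L) + 1 + 1 from rfl,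
          add_mul (A * (1 + n + m + L) + 1) 1, hS2]; omega) fun _ _ h => h
  rintro σ - ⟨hσ, hσ0, hσ6, hσ7, hσ10, hσ20⟩
  refine WP.seq (WP.mono (wp_search hI h1 h2 hM le_rfl hσ hσ10) le_rfl ?_)
  rintro τ hF ⟨hτ, hres⟩
  have t6 := (hF.real 6 (by decide)).trans hσ6
  have t7 := (hF.real 7 (by decide)).trans hσ7
  have t20 := (hF.real 20 (by decide)).trans hσ20
  rcases hres with ⟨hf26, P, hsh, hP, hf⟩ | ⟨hf26, h0, ha, hra, hlt⟩
  · refine WP.cond (fun _ => WP.skip_le (by omega) (Or.inl ⟨P, hsh, hP, fun Q hQ => ?_⟩))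
      fun h => absurd ?_ h
    · have := hI.totalFuel_nonneg hQ.1.param_mem
      have : 0 ≤ (1 + ε) * I.totalFuel Q := by positivity
      linarith
    · simp [Test.Holds, hf26, hτ.n6]
  · refine WP.cond (fun h => absurd h ?_) fun _ => WP.pre (os := [_, _]) ?_
    · simp [Test.Holds, hf26]
    have hF0 := hI.fullFuel_nonneg
    refine wp_mainLoop hI h1 h2 hM (q := q) (by linarith) hMq hqε _ (X := n * I.fullFuel)
      (by positivity) (hτ.of_eq ?_ ?_ rfl) ?_ ?_ ?_ ?_ (Or.inl ⟨?_, fun Q hQ => ?_⟩)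
    · intro x hx hx'
      have hx26 : x ≠ 26 := by omega
      simp [Op.apply, Memory.setReal, Memory.setNat, Function.update_of_ne hx26]
    · intro x hx
      simp [Op.apply, Memory.setReal, Memory.setNat, Function.update_of_ne hx.ne]
    · simp [Op.apply, Memory.setReal, Memory.setNat, t7, t20]
    · simpa [Op.apply, Memory.setReal, Memory.setNat] using t6
    · simp [Op.apply, Memory.setReal, Memory.setNat]
    · intro Q hQ
      have hQ0 := hlt Q hQ
      have hfull : I.fullFuel ≤ m * (2 ^ L * I.totalFuel Q) := by
        rcases hL with ⟨R, hR, hR0⟩ | hL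
        · exact absurd (hlt R hR) (by rw [hR0]; exact lt_irrefl _)
        · have := Finset.sum_le_card_nsmul Finset.univ (fun e => I.fuel e 1)
            (2 ^ L * I.totalFuel Q) fun e _ => hL Q hQ e 1 ⟨zero_le_one, le_rfl⟩
          simpa [Instance.fullFuel] using this
      have hA : (2 : ℝ) ≤ q ^ A := by
        have h3 := one_add_mul_le_pow (a := ε₁) (by linarith) A
        have h4 : 1 / ε₁ ≤ A := Nat.le_ceil _
        rw [div_le_iff₀ hε0] at h4
        linarith
      have hn2 : (n : ℝ) < 2 ^ n := by exact_mod_cast Nat.lt_two_pow_self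
      have hm2 : (m : ℝ) < 2 ^ m := by exact_mod_cast Nat.lt_two_pow_self
      -- The four factors dominate q ≤ 2, n, m and 2^L in the ratio of starting bound to optimum.
      have hpow : (2 : ℝ) * (2 ^ n * 2 ^ m * 2 ^ L) ≤ q ^ (A * (1 + n + m + L)) := by
        rw [pow_mul]
        calc (2 : ℝ) * (2 ^ n * 2 ^ m * 2 ^ L) = 2 ^ (1 + n + m + L) := by ring
          _ ≤ _ := pow_le_pow_left₀ zero_le_two hA _
      have hnm : (n : ℝ) * m < 2 ^ n * 2 ^ m :=
        mul_lt_mul'' hn2 hm2 hnr.le m.cast_nonneg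
      calc q * (n * I.fullFuel) ≤ 2 * (n * (m * (2 ^ L * I.totalFuel Q))) := by
            gcongr; linarith
        _ = 2 * ((n * m) * 2 ^ L) * I.totalFuel Q := by ring
        _ < 2 * ((2 ^ n * 2 ^ m) * 2 ^ L) * I.totalFuel Q := by gcongr
        _ ≤ _ := mul_le_mul_of_nonneg_right hpow hQ0.le
    · simpa [Op.apply, Memory.setReal, Memory.setNat] using h0.trans hσ0
    · obtain ⟨P, hP, hl, -⟩ := hI.exists_short h1 h2 hQ
      refine ⟨P, hP, (hI.totalFuel_le_length_mul hP.1.param_mem).trans ?_⟩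
      gcongr

/-! ### Polynomial running time -/

/-- The running time is polynomial. -/
theorem scheme_time_le {n m L z M A : ℕ} (hz : 1 ≤ z) (hn : n ≤ z) (hm : m ≤ z) (hL : L ≤ z)
    (hA : A ≤ 5 * z) (hM : M ≤ 5 * z ^ 2) :
    3 * n + 5 * M + 5 * m + 20 + (A * (1 + n + m + L) + 2) *
      (9 * roundTime n m (M + n + 1) + 22) ≤ 500000 * z ^ 8 := by
  have hzp : ∀ {i j}, i ≤ j → z ^ i ≤ z ^ j := fun h => Nat.pow_le_pow_right hz h
  have hz0 : ∀ i, 1 ≤ z ^ i := fun i => Nat.one_le_pow _ _ hz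
  have e1 := hzp (show 1 ≤ 2 by decide)
  have e0 := hz0 2
  rw [pow_one] at e1
  have hJ : M + n + 1 ≤ 7 * z ^ 2 := by omega
  have a1 : m * 38 + 7 ≤ 45 * z := by omega
  have a2 : (M + n + 1) * (m * 38 + 7) + 8 ≤ 323 * z ^ 3 :=
    calc _ ≤ 7 * z ^ 2 * (45 * z) + 8 * z ^ 3 :=
          add_le_add (Nat.mul_le_mul hJ a1) (by have := hz0 3; omega)
      _ = _ := by ring
  have a3 : (M + n + 1) * ((M + n + 1) * (m * 38 + 7) + 8) + 5 ≤ 2266 * z ^ 5 :=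
    calc _ ≤ 7 * z ^ 2 * (323 * z ^ 3) + 5 * z ^ 5 :=
          add_le_add (Nat.mul_le_mul hJ a2) (by have := hz0 5; omega)
      _ = _ := by ring
  have a4 : roundTime n m (M + n + 1) ≤ 2268 * z ^ 6 :=
    calc _ ≤ z * (2266 * z ^ 5) + 2 * z ^ 6 :=
          add_le_add (Nat.mul_le_mul hn a3) (by have := hz0 6; omega)
      _ = _ := by ring
  have a5 : 9 * roundTime n m (M + n + 1) + 22 ≤ 20434 * z ^ 6 := by
    have := hz0 6
    omega
  have a6 : A * (1 + n + m + L) + 2 ≤ 22 * z ^ 2 :=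
    calc _ ≤ 5 * z * (4 * z) + 2 * z ^ 2 :=
          add_le_add (Nat.mul_le_mul hA (by omega)) (by omega)
      _ = _ := by ring
  have a7 : 3 * n + 5 * M + 5 * m + 20 ≤ 53 * z ^ 8 := by
    have := hzp (show 2 ≤ 8 by decide)
    omega
  calc _ ≤ 53 * z ^ 8 + 22 * z ^ 2 * (20434 * z ^ 6) := add_le_add a7 (Nat.mul_le_mul a6 a5)
    _ = 449601 * z ^ 8 := by ring
    _ ≤ _ := by gcongr; decide

theorem exists_scheme_run (hI : I.Admissible) (h1 : I.CyclePreventionI)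
    (h2 : I.CyclePreventionII) {ε : ℝ} (hε : 0 < ε) {L : ℕ} (hL : I.FuelRange L) :
    ∃ (τ : Memory) (T : ℕ), Exec I scheme (inputMemory I ε) τ T ∧ IsApproxAnswer I ε τ ∧
      (T : ℝ) ≤ 500000 * 2 ^ 8 * (n + m + L + 1 / ε) ^ 8 := by
  obtain ⟨τ, T, hE, hT, hans⟩ := wp_scheme hI h1 h2 hε rfl hL
  refine ⟨τ, T, hE, hans, ?_⟩
  set Z : ℝ := n + m + L + 1 / ε with hZ
  have hn : (1 : ℝ) ≤ n := by exact_mod_cast I.s.pos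
  have hε' : 0 < 1 / ε := by positivity
  have hm0 : (0 : ℝ) ≤ m := m.cast_nonneg
  have hL0 : (0 : ℝ) ≤ L := L.cast_nonneg
  have hZ1 : 1 ≤ Z := by linarith
  set z := ⌈Z⌉₊ with hz
  have hZz : Z ≤ z := Nat.le_ceil _
  -- Since Z ≥ 1, rounding up at most doubles it; this accounts for the factor 2^8.
  have hz2 : (z : ℝ) ≤ 2 * Z := by
    have := Nat.ceil_lt_add_one (zero_le_one.trans hZ1)
    linarith
  have hz1 : 1 ≤ z := by exact_mod_cast hZ1.trans hZz
  have hinv : 1 / (ε / (3 + ε)) = 3 * (1 / ε) + 1 := by field_simp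
  have hb : T ≤ 500000 * z ^ 8 := by
    refine hT.trans (scheme_time_le hz1 ?_ ?_ ?_ ?_ ?_)
    · exact (Nat.cast_le (α := ℝ)).1 (by linarith)
    · exact (Nat.cast_le (α := ℝ)).1 (by linarith)
    · exact (Nat.cast_le (α := ℝ)).1 (by linarith)
    · refine Nat.ceil_le.2 ?_
      rw [hinv]
      push_cast
      linarith
    · refine Nat.ceil_le.2 ?_
      rw [div_eq_mul_one_div, hinv]
      push_cast
      have h4 : (n : ℝ) ≤ z := by linarith
      have h3 : (n : ℝ) * (1 / ε) ≤ z * z :=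
        mul_le_mul h4 (by linarith) hε'.le (by linarith)
      have h5 : (z : ℝ) ≤ z * z := by nlinarith
      nlinarith
  calc (T : ℝ) ≤ 500000 * (z : ℝ) ^ 8 := by exact_mod_cast hb
    _ ≤ 500000 * (2 * Z) ^ 8 := by gcongr
    _ = _ := by ring

end HybridRouting

open HybridRouting in
theorem mainTheorem1 :
    ∃ (c : Program) (K d : ℕ), ∀ (n m : ℕ) (I : Instance n m),
      I.Admissible → I.CyclePreventionI → I.CyclePreventionII → ∀ ε : ℝ, 0 < ε →
      ∃ (τ : Memory) (T : ℕ), Exec I c (inputMemory I ε) τ T ∧ IsApproxAnswer I ε τ ∧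
        (∀ L : ℕ, I.FuelRange L → (T : ℝ) ≤ K * (n + m + L + 1 / ε) ^ d) ∧
        (∀ D : LinearData m, D.Represents I →
          (T : ℝ) ≤ K * (n + m + D.bitLength + 1 / ε) ^ d) := by
  refine ⟨scheme, 500000 * 10 ^ 8, 8, fun n m I hI h1 h2 ε hε => ?_⟩
  classical
  have hex := hI.exists_fuelRange h1 h2
  -- One run must satisfy the bound for every valid L, so its time is measured by the least one.
  obtain ⟨τ, T, hE, hans, hT⟩ := exists_scheme_run hI h1 h2 hε (Nat.find_spec hex)
  have hn : (1 : ℝ) ≤ n := by exact_mod_cast I.s.pos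
  have hε' : 0 < 1 / ε := by positivity
  -- Both senses of size fit: b = L for arbitrary functions, b the encoding length with L = 3b + 2
  -- for linear ones. As n ≥ 1, replacing L by b costs at most a factor 5 in the base, and 2^8 · 5^8
  -- = 10^8.
  have key : ∀ (L b : ℕ), I.FuelRange L → L ≤ 3 * b + 2 →
      (T : ℝ) ≤ (500000 * 10 ^ 8 : ℕ) * (n + m + b + 1 / ε) ^ 8 := by
    intro L b hL hb
    have h3 : ((Nat.find hex : ℕ) : ℝ) ≤ L := by exact_mod_cast Nat.find_min' hex hL
    have h4 : (L : ℝ) ≤ 3 * b + 2 := by exact_mod_cast hb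
    have h5 : (0 : ℝ) ≤ m := m.cast_nonneg
    have h6 : (0 : ℝ) ≤ b := b.cast_nonneg
    calc (T : ℝ) ≤ 500000 * 2 ^ 8 * (n + m + (Nat.find hex : ℕ) + 1 / ε) ^ 8 := hT
      _ ≤ 500000 * 2 ^ 8 * (5 * (n + m + b + 1 / ε)) ^ 8 := by
        gcongr
        linarith
      _ = _ := by push_cast; ring
  exact ⟨τ, T, hE, hans, fun L hL => key L L hL (by omega),
    fun D hD => key _ _ (hD.fuelRange hI h1) le_rfl⟩
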